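/- **Setting.** Let $D\ge 1$, $d=D+1$, $m>0$, $\omega_{\mathbf p}=\sqrt{m^2+\mathbf p^2}$ and $\mathrm d\mu(\mathbf p)=\frac{1}{2\omega_{\mathbf p}}\frac{\mathrm d^D\mathbf p}{(2\pi)^D}$ on $\mathbb R^D$. For a Schwartz function $h\in\mathcal S(\mathbb R^d)$ (complex-valued) put $\tilde h(k^0,\mathbf k)=\int h(x)\,e^{-\mathrm i(-k^0x^0+\mathbf k\cdot\mathbf x)}\,\mathrm d^dx$. Let $\mathcal F=\bigoplus_{n\ge0}L^2_{\mathrm{sym}}((\mathbb R^D)^n,\mu^{\otimes n})$ be the symmetric Fock space over $L^2(\mathbb R^D,\mu)$, with annihilation and creation operators $a(\mathbf p),a^\dagger(\mathbf p)$, $[a(\mathbf p),a^\dagger(\mathbf q)]\,\mathrm d\mu(\mathbf p)=\delta(\mathbf p-\mathbf q)\,\mathrm d^D\mathbf p$, and let $\mathcal F_0\subset\mathcal F$ be the subspace of vectors with only finitely many non-zero $n$-particle components; $\psi$ contains at most $n$ particles if $\psi^{(l)}=0$ for all $l>n$. The complexified one-particle space $\mathcal H$ consists of the pairs $f=(f_+,f_-)$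 with $f_\pm\in L^2(\mathbb R^D,\mu)$; a Schwartz function $f$ on $\mathbb R^d$ is identified with $f_\pm(\mathbf p)=\tilde f(\pm\omega_{\mathbf p},\pm\mathbf p)$, and $f\in\mathcal H$ is called real if $f_-=\overline{f_+}$. On $\mathcal F_0$ define, for $f\in\mathcal H$ and $h\in\mathcal S(\mathbb R^d)$, $$\Phi(f)=\frac1{\sqrt2}\int\bigl[f_-(\mathbf p)\,a(\mathbf p)+f_+(\mathbf p)\,a^\dagger(\mathbf p)\bigr]\mathrm d\mu(\mathbf p),$$ $$:\!\Phi^2\!:\!(h)=\frac12\iint\bigl[\tilde h(-\omega_{\mathbf p}-\omega_{\mathbf q},-\mathbf p-\mathbf q)\,a(\mathbf p)a(\mathbf q)+2\tilde h(\omega_{\mathbf p}-\omega_{\mathbf q},\mathbf p-\mathbf q)\,a^\dagger(\mathbf p)a(\mathbf q)+\tilde h(\omega_{\mathbf p}+\omega_{\mathbf q},\mathbf p+\mathbf q)\,a^\dagger(\mathbf p)a^\dagger(\mathbf q)\bigr]\mathrm d\mu(\mathbf p)\,\mathrm d\mu(\mathbf q).$$ Put $$c(h)=\sup_{\mathbf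 p,\mathbf k,\pm,\pm}\frac{\omega_{\mathbf p}^{D+1}}{m^2}\bigl|\tilde h(\pm\omega_{\mathbf p+\mathbf k}\pm\omega_{\mathbf k},\mathbf p)\bigr|$$ (independent signs) and $$K(f,h)=\max\Bigl[\|f_+\|_{L^2(\mu)},\ \|f_-\|_{L^2(\mu)},\ c(h),\ \max_{\pm}\Bigl(\iint\bigl|\tilde h(\pm(\omega_{\mathbf p}+\omega_{\mathbf q}),\mathbf p+\mathbf q)\bigr|^2\mathrm d\mu(\mathbf p)\,\mathrm d\mu(\mathbf q)\Bigr)^{1/2}\Bigr].$$ **Lemma.** For all $f\in\mathcal H$ and $h\in\mathcal S(\mathbb R^d)$ the operators $\Phi(f)$ and $:\!\Phi^2\!:\!(h)$ are well defined on $\mathcal F_0$ and map $\mathcal F_0$ into itself. For all $k,n\ge0$, $f_1,\dots,f_k\in\mathcal H$, $h_1,\dots,h_k\in\mathcal S(\mathbb R^d)$ and every $\psi\in\mathcal F_0$ containing at most $n$ particles, $$\Bigl\|\prod_{j=1}^k\bigl[\Phi(f_j)+:\!\Phi^2\!:\!(h_j)\bigr]\psi\Bigr\|\le\frac{20^k\,\Gamma\bigl(k+\frac{n+1}2\bigr)}{\Gamma\bigl(\frac{n+1}2\bigr)}\prod_{j=1}^kK(f_j,h_j)\,\|\psi\|,$$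 and $K(\alpha f,\beta h)\le\max(\alpha,\beta)K(f,h)$ for all $\alpha,\beta\ge0$. Moreover, for all $f\in\mathcal H$, $h\in\mathcal S(\mathbb R^d)$ and $\alpha,\beta\in\mathbb C$ such that $\alpha f$ is real and $\beta h$ is real-valued (in particular for real $\alpha,\beta$, real $f$ and real-valued $h$), the operator $\alpha\Phi(f)+\beta:\!\Phi^2\!:\!(h)$ with domain $\mathcal F_0$ is densely defined, symmetric and essentially self-adjoint. -/

import Mathlib

open MeasureTheory
open scoped ComplexConjugate

noncomputable section

namespace FreeField

/-- Momentum space `ℝ^D`. -/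
abbrev Momentum (D : ℕ) : Type := EuclideanSpace ℝ (Fin D)

/-- Minkowski space `ℝ^(D+1)`; the coordinate `x 0` is time. -/
abbrev Spacetime (D : ℕ) : Type := EuclideanSpace ℝ (Fin (D + 1))

/-- The energy `ω_p = √(m² + p²)`. -/
def energy (D : ℕ) (m : ℝ) (p : Momentum D) : ℝ := Real.sqrt (m ^ 2 + ‖p‖ ^ 2)

/-- The measure `dμ(p) = (2 ω_p)⁻¹ d^D p / (2π)^D` on the mass shell. -/
def shellMeasure (D : ℕ) (m : ℝ) : Measure (Momentum D) :=
  (volume : Measure (Momentum D)).withDensity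
    fun p => ENNReal.ofReal (1 / (2 * energy D m p * (2 * Real.pi) ^ D))

instance shellMeasure_sigmaFinite (D : ℕ) (m : ℝ) : SigmaFinite (shellMeasure D m) := by
  unfold shellMeasure
  exact SigmaFinite.withDensity_of_ne_top' (by simp)

/-- The Fourier transform `h̃(k⁰, k) = ∫ h(x) exp(-i (-k⁰ x⁰ + k · x)) dx`. -/
def fourierM {D : ℕ} (h : SchwartzMap (Spacetime D) ℂ) (k0 : ℝ) (k : Momentum D) : ℂ :=
  ∫ x : Spacetime D, h x *
    Complex.exp (-Complex.I * ((-(k0 * x 0) + ∑ i : Fin D, k i * x i.succ : ℝ) : ℂ))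

/-! ### Fock space -/

/-- The one-particle Hilbert space `L²(ℝ^D, dμ)`. The map `f ↦ f̃(ω_p, p)` identifies it with the
completion of the real Schwartz functions modulo those vanishing on the mass shell. -/
abbrev OneParticle (D : ℕ) (m : ℝ) : Type := Lp ℂ 2 (shellMeasure D m)

/-- The product measure `μ^{⊗n}`. -/
abbrev shellPi (D : ℕ) (m : ℝ) (n : ℕ) : Measure (Fin n → Momentum D) :=
  Measure.pi fun _ : Fin n => shellMeasure D m

theorem measurePreserving_perm (D : ℕ) (m : ℝ) (n : ℕ) (σ : Equiv.Perm (Fin n)) :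
    MeasurePreserving (fun P : Fin n → Momentum D => P ∘ σ) (shellPi D m n) (shellPi D m n) := by
  have h := measurePreserving_piCongrLeft (fun _ : Fin n => shellMeasure D m) σ.symm
  convert h using 1
  funext P i
  obtain ⟨j, rfl⟩ := σ.symm.surjective i
  rw [MeasurableEquiv.coe_piCongrLeft, Equiv.piCongrLeft_apply_apply]
  simp

/-- The symmetric `n`-particle space: square-integrable functions of `n` momenta that are invariant
under permutations of the arguments. -/
def NParticle (D : ℕ) (m : ℝ) (n : ℕ) : Submodule ℂ (Lp ℂ 2 (shellPi D m n)) where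
  carrier := {g | ∀ σ : Equiv.Perm (Fin n),
    Lp.compMeasurePreserving _ (measurePreserving_perm D m n σ) g = g}
  zero_mem' := fun σ => map_zero _
  add_mem' := fun {a b} ha hb σ => by rw [map_add, ha σ, hb σ]
  smul_mem' := fun c g hg σ => by
    have h := (Lp.compMeasurePreservingₗ ℂ _ (measurePreserving_perm D m n σ)
      (E := ℂ) (p := 2)).map_smul c g
    exact h.trans (congrArg (fun u => c • u) (hg σ))

theorem NParticle_isClosed (D : ℕ) (m : ℝ) (n : ℕ) :
    IsClosed (NParticle D m n : Set (Lp ℂ 2 (shellPi D m n))) := by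
  have : (NParticle D m n : Set (Lp ℂ 2 (shellPi D m n))) =
      ⋂ σ : Equiv.Perm (Fin n), {g | Lp.compMeasurePreserving _
        (measurePreserving_perm D m n σ) g = g} := by
    ext g
    simp only [Set.mem_iInter, Set.mem_setOf_eq]
    rfl
  rw [this]
  exact isClosed_iInter fun σ =>
    isClosed_eq (Lp.isometry_compMeasurePreserving _).continuous continuous_id

instance NParticle_complete (D : ℕ) (m : ℝ) (n : ℕ) : CompleteSpace (NParticle D m n) :=
  (NParticle_isClosed D m n).completeSpace_coe

/-- The symmetric Fock space: the Hilbert direct sum of the `n`-particle spaces. -/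
abbrev Fock (D : ℕ) (m : ℝ) : Type := lp (fun n : ℕ => NParticle D m n) 2

/-- The component `ψ^{(n)}` of a Fock space vector, as a function of `n` momenta. -/
def wave {D : ℕ} {m : ℝ} (ψ : Fock D m) (n : ℕ) : (Fin n → Momentum D) → ℂ :=
  ((ψ n : NParticle D m n) : Lp ℂ 2 (shellPi D m n))

/-- `ψ` contains at most `n` particles. -/
def AtMost {D : ℕ} {m : ℝ} (n : ℕ) (ψ : Fock D m) : Prop := ∀ l, n < l → ψ l = 0

/-- The finite-particle subspace `F₀`. -/
def FiniteParticle (D : ℕ) (m : ℝ) : Submodule ℂ (Fock D m) where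
  carrier := {ψ | ∃ n, AtMost n ψ}
  zero_mem' := ⟨0, fun l _ => rfl⟩
  add_mem' := by
    rintro a b ⟨n, hn⟩ ⟨k, hk⟩
    refine ⟨max n k, fun l hl => ?_⟩
    rw [lp.coeFn_add, Pi.add_apply, hn l (lt_of_le_of_lt (le_max_left _ _) hl),
      hk l (lt_of_le_of_lt (le_max_right _ _) hl), add_zero]
  smul_mem' := by
    rintro c a ⟨n, hn⟩
    refine ⟨n, fun l hl => ?_⟩
    rw [lp.coeFn_smul, Pi.smul_apply, hn l hl, smul_zero]

/-! ### The field -/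

/-- The complexified one-particle space of smearing functions. The element `f` is given by the
two functions `f.1 p = f̃(ω_p, p)` and `f.2 p = f̃(-ω_p, -p)`. -/
abbrev Smearing (D : ℕ) (m : ℝ) : Type := OneParticle D m × OneParticle D m

/-- The real elements: those with `f̃(-ω_p, -p) = conj f̃(ω_p, p)`. -/
def Smearing.IsReal {D : ℕ} {m : ℝ} (f : Smearing D m) : Prop :=
  f.2 =ᵐ[shellMeasure D m] fun p => conj (f.1 p)

/-- The `n`-particle component of `∫ u(p) a(p) dμ(p) ψ`. -/
def annTerm {D : ℕ} {m : ℝ} (u : Momentum D → ℂ) (ψ : Fock D m) (n : ℕ)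
    (P : Fin n → Momentum D) : ℂ :=
  (Real.sqrt (n + 1) : ℂ) *
    ∫ q, u q * wave ψ (n + 1) (Matrix.vecCons q P) ∂(shellMeasure D m)

/-- The `n`-particle component of `∫ u(p) a†(p) dμ(p) ψ`. -/
def creTerm {D : ℕ} {m : ℝ} (u : Momentum D → ℂ) (ψ : Fock D m) :
    (n : ℕ) → (Fin n → Momentum D) → ℂ
  | 0, _ => 0
  | n + 1, P => (Real.sqrt (n + 1) : ℂ)⁻¹ *
      ∑ i : Fin (n + 1), u (P i) * wave ψ n (fun l => P (i.succAbove l))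

/-- `T` is the field operator on `F₀`:
`T = 2^{-1/2} ∫ [f̃(-ω_p, -p) a(p) + f̃(ω_p, p) a†(p)] dμ(p)`. -/
def IsField {D : ℕ} {m : ℝ} (f : Smearing D m) (T : Module.End ℂ (FiniteParticle D m)) : Prop :=
  ∀ (ψ : FiniteParticle D m) (n : ℕ),
    wave (T ψ : Fock D m) n =ᵐ[shellPi D m n] fun P =>
      (Real.sqrt 2 : ℂ)⁻¹ * (annTerm f.2 (ψ : Fock D m) n P + creTerm f.1 (ψ : Fock D m) n P)

/-! ### The Wick square -/

/-- The `n`-particle component of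
`∬ h̃(-ω_p-ω_q, -p-q) a(p) a(q) dμ(p) dμ(q) ψ`. -/
def annAnnTerm {D : ℕ} {m : ℝ} (h : SchwartzMap (Spacetime D) ℂ) (ψ : Fock D m) (n : ℕ)
    (P : Fin n → Momentum D) : ℂ :=
  (Real.sqrt ((n + 1) * (n + 2)) : ℂ) *
    ∫ p, ∫ q, fourierM h (-energy D m p - energy D m q) (-p - q) *
      wave ψ (n + 2) (Matrix.vecCons p (Matrix.vecCons q P)) ∂(shellMeasure D m) ∂(shellMeasure D m)

/-- The `n`-particle component of
`∬ h̃(ω_p-ω_q, p-q) a†(p) a(q) dμ(p) dμ(q) ψ`. -/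
def creAnnTerm {D : ℕ} {m : ℝ} (h : SchwartzMap (Spacetime D) ℂ) (ψ : Fock D m) (n : ℕ)
    (P : Fin n → Momentum D) : ℂ :=
  ∑ i : Fin n, ∫ q, fourierM h (energy D m (P i) - energy D m q) (P i - q) *
    wave ψ n (Function.update P i q) ∂(shellMeasure D m)

/-- The `n`-particle component of
`∬ h̃(ω_p+ω_q, p+q) a†(p) a†(q) dμ(p) dμ(q) ψ`; the double sum runs over the ordered pairs of
distinct arguments. -/
def creCreTerm {D : ℕ} {m : ℝ} (h : SchwartzMap (Spacetime D) ℂ) (ψ : Fock D m) :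
    (n : ℕ) → (Fin n → Momentum D) → ℂ
  | 0, _ => 0
  | 1, _ => 0
  | n + 2, P => (Real.sqrt ((n + 1) * (n + 2)) : ℂ)⁻¹ *
      ∑ i : Fin (n + 2), ∑ j : Fin (n + 1),
        fourierM h (energy D m (P i) + energy D m (P (i.succAbove j)))
          (P i + P (i.succAbove j)) *
        wave ψ n (fun l => P (i.succAbove (j.succAbove l)))

/-- `T` is the Wick square on `F₀`, that is, the normally ordered square of the field smeared
with `h`:
`T = (1/2) ∬ [h̃(-ω_p-ω_q, -p-q) a(p) a(q) + 2 h̃(ω_p-ω_q, p-q) a†(p) a(q)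
  + h̃(ω_p+ω_q, p+q) a†(p) a†(q)] dμ(p) dμ(q)`. -/
def IsWickSquare {D : ℕ} {m : ℝ} (h : SchwartzMap (Spacetime D) ℂ)
    (T : Module.End ℂ (FiniteParticle D m)) : Prop :=
  ∀ (ψ : FiniteParticle D m) (n : ℕ),
    wave (T ψ : Fock D m) n =ᵐ[shellPi D m n] fun P =>
      (1 / 2 : ℂ) * (annAnnTerm h (ψ : Fock D m) n P + 2 * creAnnTerm h (ψ : Fock D m) n P
        + creCreTerm h (ψ : Fock D m) n P)

/-- An operator on `F₀` is determined by the wave functions of its values. -/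
theorem end_ext {D : ℕ} {m : ℝ} {T S : Module.End ℂ (FiniteParticle D m)}
    (h : ∀ (ψ : FiniteParticle D m) (n : ℕ),
      wave (T ψ : Fock D m) n =ᵐ[shellPi D m n] wave (S ψ : Fock D m) n) : T = S := by
  refine LinearMap.ext fun ψ => Subtype.ext (lp.ext (funext fun n => Subtype.ext ?_))
  exact Lp.ext (h ψ n)

theorem IsField.unique {D : ℕ} {m : ℝ} {f : Smearing D m}
    {T S : Module.End ℂ (FiniteParticle D m)} (hT : IsField f T) (hS : IsField f S) : T = S :=
  end_ext fun ψ n => (hT ψ n).trans (hS ψ n).symm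

theorem IsWickSquare.unique {D : ℕ} {m : ℝ} {h : SchwartzMap (Spacetime D) ℂ}
    {T S : Module.End ℂ (FiniteParticle D m)} (hT : IsWickSquare h T) (hS : IsWickSquare h S) :
    T = S :=
  end_ext fun ψ n => (hT ψ n).trans (hS ψ n).symm

/-- The field operator `Φ(f)` on `F₀`, the unique operator with `IsField f`. -/
def field {D : ℕ} {m : ℝ} (f : Smearing D m) : Module.End ℂ (FiniteParticle D m) :=
  Classical.epsilon (IsField f)

/-- The Wick square `:Φ²:(h)` on `F₀`, the unique operator with `IsWickSquare h`. -/
def wickSquare {D : ℕ} (m : ℝ) (h : SchwartzMap (Spacetime D) ℂ) :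
    Module.End ℂ (FiniteParticle D m) :=
  Classical.epsilon (IsWickSquare h)

/-! ### The constants -/

/-- `c(h) = sup (ω_p^{D+1} / m²) |h̃(± ω_{p+k} ± ω_k, p)|` over all `p`, `k` and both signs. -/
def cConst {D : ℕ} (m : ℝ) (h : SchwartzMap (Spacetime D) ℂ) : ℝ :=
  sSup {y : ℝ | ∃ (p k : Momentum D) (s t : ℤˣ),
    y = energy D m p ^ (D + 1) / m ^ 2 *
      ‖fourierM h (((s : ℤ) : ℝ) * energy D m (p + k) + ((t : ℤ) : ℝ) * energy D m k) p‖}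

/-- `(∬ |h̃(s (ω_p + ω_q), p + q)|² dμ(p) dμ(q))^{1/2}` for a sign `s`. -/
def pairNorm {D : ℕ} (m : ℝ) (h : SchwartzMap (Spacetime D) ℂ) (s : ℤˣ) : ℝ :=
  Real.sqrt (∫ p, ∫ q, ‖fourierM h (((s : ℤ) : ℝ) * (energy D m p + energy D m q)) (p + q)‖ ^ 2
    ∂(shellMeasure D m) ∂(shellMeasure D m))

/-- The constant `K(f, h)`; `‖f.1‖` and `‖f.2‖` are the `L²(dμ)` norms of `f̃(± ω_p, ± p)`,
which agree for real `f`. -/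
def KConst {D : ℕ} {m : ℝ} (f : Smearing D m) (h : SchwartzMap (Spacetime D) ℂ) : ℝ :=
  max (max ‖f.1‖ ‖f.2‖) (max (cConst m h) (max (pairNorm m h 1) (pairNorm m h (-1))))

/-! ### Essential self-adjointness -/

/-- An operator on `F₀` as an unbounded operator on Fock space with domain `F₀`. -/
def toPMap {D : ℕ} {m : ℝ} (T : Module.End ℂ (FiniteParticle D m)) :
    Fock D m →ₗ.[ℂ] Fock D m where
  domain := FiniteParticle D m
  toFun := (FiniteParticle D m).subtype ∘ₗ T

/-- A densely defined symmetric operator is essentially self-adjoint if its closure is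
self-adjoint. -/
def IsEssentiallySelfAdjoint {H : Type*} [NormedAddCommGroup H] [InnerProductSpace ℂ H]
    [CompleteSpace H] (A : H →ₗ.[ℂ] H) : Prop :=
  Dense (A.domain : Set H) ∧ A.IsFormalAdjoint A ∧ A.IsClosable ∧ IsSelfAdjoint A.closure

end FreeField

end

/-! The operators `Φ(f)` and `:Φ²:(h)` are sums of Wick monomials, integral operators that
annihilate at most two particles and create at most two. Such an operator has a kernel bounded
on `L²`: the kernels of `a`, `a†`, `aa` and `a†a†` are Hilbert–Schmidt, and that of `a†a` obeys
Schur's test, since `h̃(ω_p - ω_q, p - q)` is dominated by the integrable function `c(h) m²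
ω_{p-q}^{-(D+1)}`. Together with the combinatorial factors this gives a bound linear in the
particle number, so that the norms of `(Φ(f) + :Φ²:(h))^k ψ` grow no faster than `k! C^k`. Every
finite-particle vector is thus analytic, and a symmetric operator with a dense invariant domain
of analytic vectors is essentially self-adjoint (Nelson). -/

noncomputable section

namespace FreeField

open scoped InnerProductSpace ENNReal NNReal FourierTransform

/-! ### Analytic vectors and essential self-adjointness -/

section AnalyticVectors

open Finset.HasAntidiagonal (antidiagonal mem_antidiagonal sigmaAntidiagonalEquivProd)

variable {𝕜 H E : Type*} [RCLike 𝕜]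

theorem inner_tsum_tsum_eq_tsum_sum_antidiagonal [NormedAddCommGroup H] [InnerProductSpace 𝕜 H]
    [CompleteSpace H] {u v : ℕ → H} (hu : Summable fun k => ‖u k‖)
    (hv : Summable fun k => ‖v k‖) :
    ⟪∑' k, u k, ∑' k, v k⟫_𝕜 = ∑' N, ∑ p ∈ antidiagonal N, ⟪u p.1, v p.2⟫_𝕜 := by
  have hs : Summable fun p : ℕ × ℕ => ⟪u p.1, v p.2⟫_𝕜 :=
    .of_norm_bounded (hu.mul_of_nonneg hv (fun _ => norm_nonneg _) fun _ => norm_nonneg _)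
      fun p => norm_inner_le_norm _ _
  have hleft (y : H) : ⟪∑' k, u k, y⟫_𝕜 = ∑' k, ⟪u k, y⟫_𝕜 :=
    ((innerSL 𝕜).flip y).map_tsum hu.of_norm
  have hright (x : H) : ⟪x, ∑' k, v k⟫_𝕜 = ∑' k, ⟪x, v k⟫_𝕜 := (innerSL 𝕜 x).map_tsum hv.of_norm
  let e := sigmaAntidiagonalEquivProd (A := ℕ)
  calc ⟪∑' k, u k, ∑' k, v k⟫_𝕜
      = ∑' p : ℕ × ℕ, ⟪u p.1, v p.2⟫_𝕜 := by simp_rw [hs.tsum_prod, hleft, hright]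
    _ = ∑' q, ⟪u (e q).1, v (e q).2⟫_𝕜 := (e.tsum_eq fun p : ℕ × ℕ => ⟪u p.1, v p.2⟫_𝕜).symm
    _ = ∑' N, ∑' p : antidiagonal N, ⟪u p.1.1, v p.1.2⟫_𝕜 :=
        (e.summable_iff.mpr hs).tsum_sigma' fun N => (hasSum_fintype _).summable
    _ = _ := tsum_congr fun N => by
        rw [tsum_fintype]
        exact Finset.sum_coe_sort (antidiagonal N) fun p => ⟪u p.1, v p.2⟫_𝕜

theorem sum_antidiagonal_pow_div_factorial {K : Type*} [Field K] [CharZero K] (a b : K) (N : ℕ) :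
    ∑ p ∈ antidiagonal N, a ^ p.1 / (p.1.factorial : K) * (b ^ p.2 / p.2.factorial) =
      (a + b) ^ N / N.factorial := by
  rw [(Commute.all a b).add_pow', Finset.sum_div]
  refine Finset.sum_congr rfl fun p hp => ?_
  obtain rfl : p.1 + p.2 = N := mem_antidiagonal.mp hp
  rw [nsmul_eq_mul, Nat.cast_add_choose]
  field_simp [Nat.factorial_ne_zero]

/-- The `k`-th term of the exponential series `exp(aT)x`, for an endomorphism `T` of a vector
space. -/
def expTerm {M : Type*} [AddCommGroup M] [Module 𝕜 M] (T : Module.End 𝕜 M) (a : 𝕜) (x : M)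
    (k : ℕ) : M :=
  (a ^ k / (k.factorial : 𝕜)) • (T ^ k) x

theorem norm_expTerm [SeminormedAddCommGroup E] [NormedSpace 𝕜 E] (T : Module.End 𝕜 E) (a : 𝕜)
    (x : E) (k : ℕ) : ‖expTerm T a x k‖ = ‖a‖ ^ k / k.factorial * ‖(T ^ k) x‖ := by
  simp [expTerm, norm_smul]

theorem sum_antidiagonal_inner_expTerm [SeminormedAddCommGroup E] [InnerProductSpace 𝕜 E]
    {T : Module.End 𝕜 E} (hT : T.IsSymmetric) (a b : 𝕜) (x y : E) (N : ℕ) :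
    ∑ p ∈ antidiagonal N, ⟪expTerm T a x p.1, expTerm T b y p.2⟫_𝕜 =
      ⟪x, expTerm T (conj a + b) y N⟫_𝕜 := by
  rw [expTerm, inner_smul_right, ← sum_antidiagonal_pow_div_factorial, Finset.sum_mul]
  refine Finset.sum_congr rfl fun p hp => ?_
  obtain rfl : p.1 + p.2 = N := mem_antidiagonal.mp hp
  rw [expTerm, expTerm, inner_smul_left, inner_smul_right, hT.pow, ← Module.End.mul_apply,
    ← pow_add, map_div₀, map_pow, map_natCast]
  ring

variable [NormedAddCommGroup H] [CompleteSpace H]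

theorem norm_tsum_expTerm_of_conj_eq_neg [InnerProductSpace 𝕜 H] {F : Submodule 𝕜 H}
    {T : Module.End 𝕜 F} (hT : T.IsSymmetric) {a : 𝕜} (ha : conj a = -a) {x : F}
    (hx : Summable fun k => ‖expTerm T a x k‖) :
    ‖∑' k, ((expTerm T a x k : F) : H)‖ = ‖x‖ := by
  have hinner : ⟪∑' k, ((expTerm T a x k : F) : H), ∑' k, ((expTerm T a x k : F) : H)⟫_𝕜 =
      ⟪x, x⟫_𝕜 :=
    calc ⟪∑' k, ((expTerm T a x k : F) : H), ∑' k, ((expTerm T a x k : F) : H)⟫_𝕜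
        = ∑' N, ∑ p ∈ antidiagonal N, ⟪expTerm T a x p.1, expTerm T a x p.2⟫_𝕜 :=
          inner_tsum_tsum_eq_tsum_sum_antidiagonal hx hx
      _ = ∑' N, ⟪x, expTerm T 0 x N⟫_𝕜 := by
          simp_rw [sum_antidiagonal_inner_expTerm hT, ha, neg_add_cancel]
      _ = ⟪x, x⟫_𝕜 := by
          rw [tsum_eq_single 0 fun N hN => by simp [expTerm, hN]]
          simp [expTerm]
  rw [inner_self_eq_norm_sq_to_K, inner_self_eq_norm_sq_to_K] at hinner
  exact (sq_eq_sq₀ (norm_nonneg _) (norm_nonneg _)).mp (by exact_mod_cast hinner)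

variable [InnerProductSpace ℂ H] {F : Submodule ℂ H} {T : Module.End ℂ F} {φ : H} {z : ℂ} {t : ℝ}

theorem inner_tsum_expTerm_of_inner_eq_mul_inner (hφ : ∀ x : F, ⟪φ, T x⟫_ℂ = z * ⟪φ, x⟫_ℂ) {a : ℂ}
    {x : F} (hx : Summable fun k => ‖expTerm T a x k‖) :
    ⟪φ, ∑' k, ((expTerm T a x k : F) : H)⟫_ℂ = Complex.exp (a * z) * ⟪φ, x⟫_ℂ := by
  have hpow (k : ℕ) : ⟪φ, (T ^ k) x⟫_ℂ = z ^ k * ⟪φ, x⟫_ℂ := by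
    induction k with
    | zero => simp
    | succ k ih => rw [pow_succ', Module.End.mul_apply, hφ, ih, pow_succ', mul_assoc]
  calc ⟪φ, ∑' k, ((expTerm T a x k : F) : H)⟫_ℂ
      = ∑' k, ⟪φ, ((expTerm T a x k : F) : H)⟫_ℂ := (innerSL ℂ φ).map_tsum (Summable.of_norm hx)
    _ = ∑' k, (a * z) ^ k / k.factorial * ⟪φ, x⟫_ℂ := tsum_congr fun k => by
        rw [expTerm, Submodule.coe_smul, inner_smul_right, hpow]; ring
    _ = Complex.exp (a * z) * ⟪φ, x⟫_ℂ := by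
        rw [tsum_mul_right, Complex.exp_eq_exp_ℂ, NormedSpace.exp_eq_tsum_div]

/-- As `⟪φ, exp(-tzT)x⟫ = eᵗ⟪φ, x⟫` while `exp(-tzT)` is isometric, `⟪φ, ·⟫` has norm at most
`e⁻ᵗ‖φ‖`. -/
theorem eq_zero_of_inner_eq_mul_inner (hF : Dense (F : Set H)) (hT : T.IsSymmetric) (ht : 0 < t)
    (hs : ∀ x : F, Summable fun k => t ^ k / k.factorial * ‖(T ^ k) x‖) (hz : conj z = -z)
    (hz' : ‖z‖ = 1) (hφ : ∀ x : F, ⟪φ, T x⟫_ℂ = z * ⟪φ, x⟫_ℂ) : φ = 0 := by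
  let a : ℂ := -(t * z)
  have ha : conj a = -a := by simp [a, hz]
  have haz : a * z = t := by
    have hzz : z * conj z = 1 := by rw [Complex.mul_conj', hz', Complex.ofReal_one, one_pow]
    linear_combination -(t : ℂ) * z * hz + t * hzz
  have hsum (x : F) : Summable fun k => ‖expTerm T a x k‖ := by
    simpa [norm_expTerm, a, hz', abs_of_pos ht] using hs x
  have hle (y : H) : Real.exp t * ‖⟪φ, y⟫_ℂ‖ ≤ ‖φ‖ * ‖y‖ := by
    refine hF.induction (P := fun y => Real.exp t * ‖⟪φ, y⟫_ℂ‖ ≤ ‖φ‖ * ‖y‖) (fun x hx => ?_)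
      (isClosed_le (by fun_prop) (by fun_prop)) y
    have h := norm_inner_le_norm (𝕜 := ℂ) φ (∑' k, ((expTerm T a ⟨x, hx⟩ k : F) : H))
    rwa [inner_tsum_expTerm_of_inner_eq_mul_inner hφ (hsum ⟨x, hx⟩), haz, norm_mul,
      Complex.norm_exp_ofReal, norm_tsum_expTerm_of_conj_eq_neg hT ha (hsum ⟨x, hx⟩)] at h
  by_contra hne
  have hself : Real.exp t * (‖φ‖ * ‖φ‖) ≤ ‖φ‖ * ‖φ‖ := by
    simpa [inner_self_eq_norm_sq_to_K, sq] using hle φ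
  have hpos : 0 < ‖φ‖ * ‖φ‖ := mul_self_pos.mpr (norm_ne_zero_iff.mpr hne)
  exact absurd ((mul_le_iff_le_one_left hpos).mp hself) (Real.one_lt_exp_iff.mpr ht).not_ge

end AnalyticVectors

section DeficiencySpaces

variable {H : Type*} [NormedAddCommGroup H] [InnerProductSpace ℂ H] {A : H →ₗ.[ℂ] H}

theorem inner_eq_of_mem_closure_graph (hA : A.IsFormalAdjoint A) {p q : H × H}
    (hp : p ∈ A.graph.topologicalClosure) (hq : q ∈ A.graph.topologicalClosure) :
    ⟪p.2, q.1⟫_ℂ = ⟪p.1, q.2⟫_ℂ := by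
  have hpq : (p, q) ∈ closure ((A.graph : Set (H × H)) ×ˢ (A.graph : Set (H × H))) := by
    rw [closure_prod_eq]
    exact ⟨hp, hq⟩
  refine closure_minimal (t := {r : (H × H) × (H × H) | ⟪r.1.2, r.2.1⟫_ℂ = ⟪r.1.1, r.2.2⟫_ℂ})
    ?_ (isClosed_eq (by fun_prop) (by fun_prop)) hpq
  rintro ⟨⟨a, a'⟩, ⟨b, b'⟩⟩ ⟨ha, hb⟩
  obtain ⟨x, rfl, rfl⟩ := (LinearPMap.mem_graph_iff A).mp ha
  obtain ⟨y, rfl, rfl⟩ := (LinearPMap.mem_graph_iff A).mp hb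
  exact hA x y

theorem norm_sq_add_I_smul {x y : H} (h : ⟪y, x⟫_ℂ = ⟪x, y⟫_ℂ) :
    ‖y + Complex.I • x‖ ^ 2 = ‖y‖ ^ 2 + ‖x‖ ^ 2 := by
  have him : (⟪y, x⟫_ℂ).im = 0 := Complex.conj_eq_iff_im.mp
    ((inner_conj_symm x y).trans h.symm)
  rw [@norm_add_sq ℂ, inner_smul_right, norm_smul, Complex.norm_I, one_mul]
  simp [him]

variable [CompleteSpace H]

theorem exists_mem_closure_graph_add_I_smul_eq (hA : A.IsFormalAdjoint A)
    (hdef : ∀ φ : H, (∀ x : A.domain, ⟪φ, A x⟫_ℂ = -Complex.I * ⟪φ, x⟫_ℂ) → φ = 0) (y : H) :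
    ∃ p ∈ A.graph.topologicalClosure, p.2 + Complex.I • p.1 = y := by
  let G : Submodule ℂ (H × H) := A.graph.topologicalClosure
  let L : G →L[ℂ] H :=
    (ContinuousLinearMap.snd ℂ H H + Complex.I • ContinuousLinearMap.fst ℂ H H).comp G.subtypeL
  have : CompleteSpace G := A.graph.isClosed_topologicalClosure.completeSpace_coe
  have hanti : AntilipschitzWith 1 L := by
    refine ContinuousLinearMap.antilipschitz_of_bound _ fun p => ?_
    have hn : ‖L p‖ ^ 2 = ‖(p : H × H).2‖ ^ 2 + ‖(p : H × H).1‖ ^ 2 :=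
      norm_sq_add_I_smul (inner_eq_of_mem_closure_graph hA p.2 p.2)
    rw [NNReal.coe_one, one_mul]
    refine max_le (le_of_sq_le_sq ?_ (norm_nonneg _)) (le_of_sq_le_sq ?_ (norm_nonneg _))
    · exact hn ▸ le_add_of_nonneg_left (sq_nonneg _)
    · exact hn ▸ le_add_of_nonneg_right (sq_nonneg _)
  have : CompleteSpace L.range :=
    (hanti.isClosed_range L.uniformContinuous).completeSpace_coe
  have hrange : L.range = ⊤ := by
    rw [← Submodule.orthogonal_eq_bot_iff, Submodule.eq_bot_iff]
    refine fun φ hφ => hdef φ fun x => ?_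
    have h := (Submodule.mem_orthogonal' _ φ).mp hφ (A x + Complex.I • (x : H))
      ⟨⟨(x, A x), A.graph.le_topologicalClosure (A.mem_graph x)⟩, rfl⟩
    rw [inner_add_right, inner_smul_right] at h
    linear_combination h
  obtain ⟨p, hp⟩ : y ∈ L.range := hrange ▸ Submodule.mem_top
  exact ⟨p, p.2, hp⟩

theorem adjoint_le_closure_of_deficiency (hd : Dense (A.domain : Set H))
    (hA : A.IsFormalAdjoint A)
    (hplus : ∀ φ : H, (∀ x : A.domain, ⟪φ, A x⟫_ℂ = Complex.I * ⟪φ, x⟫_ℂ) → φ = 0)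
    (hminus : ∀ φ : H, (∀ x : A.domain, ⟪φ, A x⟫_ℂ = -Complex.I * ⟪φ, x⟫_ℂ) → φ = 0) :
    A.adjoint ≤ A.closure := by
  have hle : A ≤ A.adjoint := hA.le_adjoint hd
  have hcl : A.adjoint.IsClosed := LinearPMap.adjoint_isClosed hd
  have hgraph : A.graph.topologicalClosure ≤ A.adjoint.graph :=
    A.graph.topologicalClosure_minimal (LinearPMap.le_graph_of_le hle) hcl
  refine LinearPMap.le_of_le_graph ?_
  rintro ⟨x, y⟩ hxy
  obtain ⟨⟨x', y'⟩, hp, heq⟩ :=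
    exists_mem_closure_graph_add_I_smul_eq hA hminus (y + Complex.I • x)
  have hsub : (x - x', y - y') ∈ A.adjoint.graph := sub_mem hxy (hgraph hp)
  obtain rfl : x = x' := by
    refine sub_eq_zero.mp (hplus _ fun z => ?_)
    have hy : y - y' = -(Complex.I • (x - x')) := by
      rw [← add_sub_cancel_right y (Complex.I • x), ← heq]
      module
    rw [LinearPMap.adjoint_graph_eq_graph_adjoint hd, Submodule.mem_adjoint_iff] at hsub
    have h := congr(conj $(sub_eq_zero.mp (hsub z (A z) (A.mem_graph z))))
    simp only [inner_conj_symm] at h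
    rw [h, hy, inner_neg_left, inner_smul_left, Complex.conj_I, neg_mul, neg_neg]
  obtain rfl : y' = y := add_right_cancel heq
  rwa [← (hcl.isClosable.leIsClosable hle).graph_closure_eq_closure_graph]

theorem isEssentiallySelfAdjoint_of_deficiency (hd : Dense (A.domain : Set H))
    (hA : A.IsFormalAdjoint A)
    (hplus : ∀ φ : H, (∀ x : A.domain, ⟪φ, A x⟫_ℂ = Complex.I * ⟪φ, x⟫_ℂ) → φ = 0)
    (hminus : ∀ φ : H, (∀ x : A.domain, ⟪φ, A x⟫_ℂ = -Complex.I * ⟪φ, x⟫_ℂ) → φ = 0) :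
    IsEssentiallySelfAdjoint A := by
  have hclosable : A.IsClosable :=
    (LinearPMap.adjoint_isClosed hd).isClosable.leIsClosable (hA.le_adjoint hd)
  have hgraph : A.graph.topologicalClosure = A.closure.graph :=
    hclosable.graph_closure_eq_closure_graph
  have hdcl : Dense (A.closure.domain : Set H) := hd.mono A.le_closure.1
  have hsymm : A.closure.IsFormalAdjoint A.closure := fun x y =>
    inner_eq_of_mem_closure_graph (p := (x, A.closure x)) (q := (y, A.closure y)) hA
      (hgraph ▸ A.closure.mem_graph x) (hgraph ▸ A.closure.mem_graph y)
  have hanti : A.closure.adjoint ≤ A.adjoint :=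
    LinearPMap.IsFormalAdjoint.le_adjoint hd fun x y => by
      rw [A.le_closure.2 (y := ⟨x, A.le_closure.1 x.2⟩) rfl]
      exact (LinearPMap.adjoint_isFormalAdjoint hdcl).symm ⟨x, A.le_closure.1 x.2⟩ y
  exact ⟨hd, hA, hclosable, LinearPMap.isSelfAdjoint_def.mpr <| le_antisymm
    (hanti.trans (adjoint_le_closure_of_deficiency hd hA hplus hminus)) (hsymm.le_adjoint hdcl)⟩

end DeficiencySpaces

/-! ### Integral operators on L² -/

section Kernels

variable {𝕜 X X' Y Y' : Type*} [RCLike 𝕜] [MeasurableSpace X] [MeasurableSpace X']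
  [MeasurableSpace Y] [MeasurableSpace Y']

theorem sq_lintegral_mul_le {μ : Measure X} {f g : X → ℝ≥0∞} (hf : AEMeasurable f μ)
    (hg : AEMeasurable g μ) :
    (∫⁻ x, f x * g x ∂μ) ^ 2 ≤ (∫⁻ x, f x ^ 2 ∂μ) * ∫⁻ x, g x ^ 2 ∂μ := by
  have h := pow_le_pow_left₀ zero_le
    (ENNReal.lintegral_mul_le_Lp_mul_Lq μ Real.HolderConjugate.two_two hf hg) 2
  simp only [mul_pow, ← ENNReal.rpow_natCast, ← ENNReal.rpow_mul] at h ⊢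
  norm_num at h ⊢
  exact h

theorem eLpNorm_two_sq {E : Type*} [NormedAddCommGroup E] {μ : Measure X} (f : X → E) :
    eLpNorm f 2 μ ^ 2 = ∫⁻ x, ‖f x‖ₑ ^ 2 ∂μ := by
  have h := eLpNorm_nnreal_pow_eq_lintegral (f := f) (μ := μ) (p := 2) two_ne_zero
  simp only [NNReal.coe_ofNat, ENNReal.rpow_ofNat] at h
  exact h

theorem ae_ae_swap {μ : Measure X} {ν : Measure Y} [SFinite μ] [SFinite ν] {p : X × Y → Prop}
    (h : ∀ᵐ z ∂μ.prod ν, p z) : ∀ᵐ y ∂ν, ∀ᵐ x ∂μ, p (x, y) :=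
  Measure.ae_ae_of_ae_prod (p := fun z : Y × X => p (z.2, z.1))
    ((Measure.measurePreserving_swap (μ := ν) (ν := μ)).quasiMeasurePreserving.ae h)

theorem measurePreserving_prod_swap_fst (μ : Measure X) (μ' : Measure X') (ν : Measure Y)
    [SFinite μ] [SFinite μ'] [SFinite ν] :
    MeasurePreserving (fun p : (X × Y) × X' => ((p.2, p.1.2), p.1.1))
      ((μ.prod ν).prod μ') ((μ'.prod ν).prod μ) :=
  (Measure.measurePreserving_swap.prod (MeasurePreserving.id μ)).comp
    (Measure.measurePreserving_swap.comp (measurePreserving_prodAssoc μ ν μ'))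

theorem measurableEmbedding_prod_swap_fst :
    MeasurableEmbedding fun p : (X × Y) × X' => ((p.2, p.1.2), p.1.1) :=
  MeasurableEquiv.measurableEmbedding
    { toFun := fun p : (X × Y) × X' => ((p.2, p.1.2), p.1.1)
      invFun := fun p => ((p.2, p.1.2), p.1.1)
      left_inv := fun _ => rfl
      right_inv := fun _ => rfl
      measurable_toFun := by
        change Measurable fun p : (X × Y) × X' => ((p.2, p.1.2), p.1.1)
        fun_prop
      measurable_invFun := by
        change Measurable fun p : (X' × Y) × X => ((p.2, p.1.2), p.1.1)
        fun_prop }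

/-- A measurable kernel whose absolute value defines an integral operator of norm at most `C` from
`L²(μ)` to `L²(μ')`. Bounding the absolute value makes all the integrals converge absolutely. -/
structure IsBoundedKernel (μ' : Measure X') (μ : Measure X) (k : X' → X → 𝕜) (C : ℝ≥0) : Prop where
  stronglyMeasurable : StronglyMeasurable (Function.uncurry k)
  bound : ∀ v : X → ℝ≥0∞, Measurable v →
    ∫⁻ x', (∫⁻ x, ‖k x' x‖ₑ * v x ∂μ) ^ 2 ∂μ' ≤ (C : ℝ≥0∞) ^ 2 * ∫⁻ x, v x ^ 2 ∂μ

variable {μ : Measure X} {μ' : Measure X'} {ν : Measure Y} {ν' : Measure Y'} {k : X' → X → 𝕜}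
  {C C' : ℝ≥0}

theorem IsBoundedKernel.of_hilbertSchmidt [SFinite μ]
    (hk : StronglyMeasurable (Function.uncurry k))
    (hC : ∫⁻ x', ∫⁻ x, ‖k x' x‖ₑ ^ 2 ∂μ ∂μ' ≤ (C : ℝ≥0∞) ^ 2) : IsBoundedKernel μ' μ k C := by
  refine ⟨hk, fun v hv => ?_⟩
  calc ∫⁻ x', (∫⁻ x, ‖k x' x‖ₑ * v x ∂μ) ^ 2 ∂μ'
      ≤ ∫⁻ x', (∫⁻ x, ‖k x' x‖ₑ ^ 2 ∂μ) * ∫⁻ x, v x ^ 2 ∂μ ∂μ' :=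
        lintegral_mono fun x' => sq_lintegral_mul_le
          (hk.comp_measurable measurable_prodMk_left).enorm.aemeasurable hv.aemeasurable
    _ = (∫⁻ x', ∫⁻ x, ‖k x' x‖ₑ ^ 2 ∂μ ∂μ') * ∫⁻ x, v x ^ 2 ∂μ :=
        lintegral_mul_const _ (hk.enorm.pow_const 2).lintegral_prod_right'
    _ ≤ (C : ℝ≥0∞) ^ 2 * ∫⁻ x, v x ^ 2 ∂μ := by gcongr

theorem IsBoundedKernel.of_schur [SFinite μ] [SFinite μ']
    (hk : StronglyMeasurable (Function.uncurry k))
    (hr : ∀ x', ∫⁻ x, ‖k x' x‖ₑ ∂μ ≤ C) (hc : ∀ x, ∫⁻ x', ‖k x' x‖ₑ ∂μ' ≤ C) :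
    IsBoundedKernel μ' μ k C := by
  refine ⟨hk, fun v hv => ?_⟩
  have hrow (x' : X') :
      (∫⁻ x, ‖k x' x‖ₑ * v x ∂μ) ^ 2 ≤ C * ∫⁻ x, ‖k x' x‖ₑ * v x ^ 2 ∂μ := by
    have hroot : AEMeasurable (fun x => ‖k x' x‖ₑ ^ (1 / 2 : ℝ)) μ :=
      ((hk.comp_measurable measurable_prodMk_left).enorm.pow_const _).aemeasurable
    have hsq (a : ℝ≥0∞) : (a ^ (1 / 2 : ℝ)) ^ 2 = a := by
      rw [← ENNReal.rpow_natCast, ← ENNReal.rpow_mul]; norm_num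
    have h := sq_lintegral_mul_le hroot (hroot.mul hv.aemeasurable)
    simp only [Pi.mul_apply, ← mul_assoc, ← sq, mul_pow, hsq] at h
    exact h.trans (by gcongr; exact hr x')
  have hcol (x : X) : ∫⁻ x', ‖k x' x‖ₑ * v x ^ 2 ∂μ' ≤ C * v x ^ 2 := by
    have hkx : Measurable fun x' => ‖k x' x‖ₑ :=
      (hk.comp_measurable measurable_prodMk_right).enorm
    rw [lintegral_mul_const _ hkx]
    gcongr
    exact hc x
  calc ∫⁻ x', (∫⁻ x, ‖k x' x‖ₑ * v x ∂μ) ^ 2 ∂μ'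
      ≤ ∫⁻ x', C * ∫⁻ x, ‖k x' x‖ₑ * v x ^ 2 ∂μ ∂μ' := lintegral_mono hrow
    _ = C * ∫⁻ x, ∫⁻ x', ‖k x' x‖ₑ * v x ^ 2 ∂μ' ∂μ := by
        rw [lintegral_const_mul' _ _ ENNReal.coe_ne_top, lintegral_lintegral_swap]
        exact (hk.enorm.mul ((hv.comp measurable_snd).pow_const 2)).aemeasurable
    _ ≤ C * ∫⁻ x, C * v x ^ 2 ∂μ := by
        gcongr with x
        exact hcol x
    _ = (C : ℝ≥0∞) ^ 2 * ∫⁻ x, v x ^ 2 ∂μ := by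
        rw [lintegral_const_mul' _ _ ENNReal.coe_ne_top, ← mul_assoc, sq]

/-- The integral operator with kernel `k` acting on the first variable of `g`. -/
def kernelInt (μ : Measure X) (k : X' → X → 𝕜) (g : X × Y → 𝕜) (z : X' × Y) : 𝕜 :=
  ∫ x, k z.1 x * g (x, z.2) ∂μ

theorem IsBoundedKernel.stronglyMeasurable_integrand (hk : IsBoundedKernel μ' μ k C)
    (g : Lp 𝕜 2 (μ.prod ν)) :
    StronglyMeasurable fun w : (X' × Y) × X => k w.1.1 w.2 * g (w.2, w.1.2) :=
  (hk.stronglyMeasurable.comp_measurable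
      ((measurable_fst.comp measurable_fst).prodMk measurable_snd)).mul
    ((Lp.stronglyMeasurable g).comp_measurable
      (measurable_snd.prodMk (measurable_snd.comp measurable_fst)))

variable [SFinite μ] [SFinite ν]

theorem kernelInt_congr {g g' : X × Y → 𝕜} (h : g =ᵐ[μ.prod ν] g') :
    kernelInt μ k g =ᵐ[μ'.prod ν] kernelInt μ k g' := by
  filter_upwards [(Measure.quasiMeasurePreserving_snd (μ := μ') (ν := ν)).ae (ae_ae_swap h)]
    with z hz
  refine integral_congr_ae ?_
  filter_upwards [hz] with x hx
  rw [hx]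

theorem kernelInt_smul (c : 𝕜) (g : Lp 𝕜 2 (μ.prod ν)) :
    kernelInt μ k (c • g : Lp 𝕜 2 (μ.prod ν)) =ᵐ[μ'.prod ν] c • kernelInt μ k g := by
  filter_upwards [kernelInt_congr (μ' := μ') (k := k) (Lp.coeFn_smul c g)] with z hsmul
  rw [hsmul]
  simp only [kernelInt, Pi.smul_apply, smul_eq_mul, mul_left_comm _ c]
  exact integral_const_mul c _

namespace IsBoundedKernel

variable [SFinite μ']

theorem lintegral_sq_le (hk : IsBoundedKernel μ' μ k C) (g : Lp 𝕜 2 (μ.prod ν)) :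
    ∫⁻ z, (∫⁻ x, ‖k z.1 x * g (x, z.2)‖ₑ ∂μ) ^ 2 ∂(μ'.prod ν)
      ≤ (C * eLpNorm g 2 (μ.prod ν)) ^ 2 := by
  have hg := Lp.stronglyMeasurable g
  rw [lintegral_prod_symm' _
      ((hk.stronglyMeasurable_integrand g).enorm.lintegral_prod_right'.pow_const 2),
    mul_pow, eLpNorm_two_sq, lintegral_prod_symm' _ (hg.enorm.pow_const 2),
    ← lintegral_const_mul' _ _ (by simp)]
  simp_rw [enorm_mul]
  exact lintegral_mono fun y => hk.bound _ (hg.comp_measurable measurable_prodMk_right).enorm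

theorem lintegral_sq_lt_top (hk : IsBoundedKernel μ' μ k C) (g : Lp 𝕜 2 (μ.prod ν)) :
    ∫⁻ z, (∫⁻ x, ‖k z.1 x * g (x, z.2)‖ₑ ∂μ) ^ 2 ∂(μ'.prod ν) < ∞ :=
  (hk.lintegral_sq_le g).trans_lt
    (ENNReal.pow_lt_top (ENNReal.mul_lt_top ENNReal.coe_lt_top (Lp.eLpNorm_lt_top g)))

theorem ae_integrable (hk : IsBoundedKernel μ' μ k C) (g : Lp 𝕜 2 (μ.prod ν)) :
    ∀ᵐ z ∂(μ'.prod ν), Integrable (fun x => k z.1 x * g (x, z.2)) μ := by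
  have hm := hk.stronglyMeasurable_integrand g
  filter_upwards [ae_lt_top' (hm.enorm.lintegral_prod_right'.pow_const 2).aemeasurable
    (hk.lintegral_sq_lt_top g).ne] with z hz
  exact ⟨(hm.comp_measurable measurable_prodMk_left).aestronglyMeasurable,
    (ENNReal.pow_lt_top_iff.mp hz).resolve_right two_ne_zero⟩

theorem eLpNorm_kernelInt_le (hk : IsBoundedKernel μ' μ k C) (g : Lp 𝕜 2 (μ.prod ν)) :
    eLpNorm (kernelInt μ k g) 2 (μ'.prod ν) ≤ C * eLpNorm g 2 (μ.prod ν) := by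
  rw [← ENNReal.pow_le_pow_left_iff two_ne_zero, eLpNorm_two_sq]
  refine le_trans ?_ (hk.lintegral_sq_le g)
  gcongr with z
  exact enorm_integral_le_lintegral_enorm _

theorem memLp_kernelInt (hk : IsBoundedKernel μ' μ k C) (g : Lp 𝕜 2 (μ.prod ν)) :
    MemLp (kernelInt μ k g) 2 (μ'.prod ν) :=
  ⟨(hk.stronglyMeasurable_integrand g).integral_prod_right'.aestronglyMeasurable,
    (hk.eLpNorm_kernelInt_le g).trans_lt
      (ENNReal.mul_lt_top ENNReal.coe_lt_top (Lp.eLpNorm_lt_top g))⟩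

theorem kernelInt_add (hk : IsBoundedKernel μ' μ k C) (g g' : Lp 𝕜 2 (μ.prod ν)) :
    kernelInt μ k (g + g' : Lp 𝕜 2 (μ.prod ν)) =ᵐ[μ'.prod ν]
      kernelInt μ k g + kernelInt μ k g' := by
  filter_upwards [kernelInt_congr (μ' := μ') (k := k) (Lp.coeFn_add g g'), hk.ae_integrable g,
    hk.ae_integrable g'] with z hadd hg hg'
  rw [hadd, Pi.add_apply]
  simp only [kernelInt, Pi.add_apply, mul_add]
  exact integral_add hg hg'

variable (ν) in
/-- The bounded operator from `L²(μ × ν)` to `L²(μ' × ν)` given by a bounded kernel acting on the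
first variable. -/
def op (hk : IsBoundedKernel μ' μ k C) : Lp 𝕜 2 (μ.prod ν) →L[𝕜] Lp 𝕜 2 (μ'.prod ν) :=
  LinearMap.mkContinuous
    { toFun := fun g => (hk.memLp_kernelInt g).toLp
      map_add' := fun g g' =>
        MemLp.toLp_congr _ ((hk.memLp_kernelInt g).add (hk.memLp_kernelInt g'))
          (hk.kernelInt_add g g')
      map_smul' := fun c g =>
        MemLp.toLp_congr _ ((hk.memLp_kernelInt g).const_smul c) (kernelInt_smul c g) }
    C fun g => by
      change ‖(hk.memLp_kernelInt g).toLp‖ ≤ C * ‖g‖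
      rw [Lp.norm_toLp, Lp.norm_def, ← ENNReal.coe_toReal C, ← ENNReal.toReal_mul]
      exact ENNReal.toReal_mono (ENNReal.mul_lt_top ENNReal.coe_lt_top (Lp.eLpNorm_lt_top g)).ne
        (hk.eLpNorm_kernelInt_le g)

theorem coeFn_op (hk : IsBoundedKernel μ' μ k C) (g : Lp 𝕜 2 (μ.prod ν)) :
    hk.op ν g =ᵐ[μ'.prod ν] kernelInt μ k g :=
  MemLp.coeFn_toLp (hk.memLp_kernelInt g)

theorem norm_op_apply_le (hk : IsBoundedKernel μ' μ k C) (g : Lp 𝕜 2 (μ.prod ν)) :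
    ‖hk.op ν g‖ ≤ C * ‖g‖ :=
  (hk.op ν).le_of_opNorm_le (LinearMap.mkContinuous_norm_le _ C.2 _) g

theorem integrable_conj_mul (hk : IsBoundedKernel μ' μ k C) (g : Lp 𝕜 2 (μ.prod ν))
    (w : Lp 𝕜 2 (μ'.prod ν)) :
    Integrable (fun p : (X' × Y) × X => conj (k p.1.1 p.2 * g (p.2, p.1.2)) * w p.1)
      ((μ'.prod ν).prod μ) := by
  have hm := hk.stronglyMeasurable_integrand g
  have hmw : StronglyMeasurable fun p : (X' × Y) × X =>
      conj (k p.1.1 p.2 * g (p.2, p.1.2)) * w p.1 :=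
    (RCLike.continuous_conj.comp_stronglyMeasurable hm).mul
      ((Lp.stronglyMeasurable w).comp_measurable measurable_fst)
  have hmz (z : X' × Y) : Measurable fun x => ‖k z.1 x * g (x, z.2)‖ₑ :=
    (hm.comp_measurable measurable_prodMk_left).enorm
  have hfactor (z : X' × Y) : ∫⁻ x, ‖conj (k z.1 x * g (x, z.2)) * w z‖ₑ ∂μ =
      (∫⁻ x, ‖k z.1 x * g (x, z.2)‖ₑ ∂μ) * ‖w z‖ₑ := by
    rw [← lintegral_mul_const _ (hmz z)]
    simp only [enorm_mul, RCLike.enorm_conj]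
  refine ⟨hmw.aestronglyMeasurable, ?_⟩
  rw [hasFiniteIntegral_iff_enorm, lintegral_prod _ hmw.enorm.aemeasurable]
  simp_rw [hfactor]
  have hsq : (∫⁻ z, (∫⁻ x, ‖k z.1 x * g (x, z.2)‖ₑ ∂μ) * ‖w z‖ₑ ∂(μ'.prod ν)) ^ 2 < ∞ := by
    refine (sq_lintegral_mul_le hm.enorm.lintegral_prod_right'.aemeasurable
      (Lp.stronglyMeasurable w).enorm.aemeasurable).trans_lt
      (ENNReal.mul_lt_top (hk.lintegral_sq_lt_top g) ?_)
    rw [← eLpNorm_two_sq]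
    exact ENNReal.pow_lt_top (Lp.eLpNorm_lt_top w)
  exact (ENNReal.pow_lt_top_iff.mp hsq).resolve_right two_ne_zero

theorem inner_op_left (hk : IsBoundedKernel μ' μ k C) {k' : X → X' → 𝕜}
    (hk' : IsBoundedKernel μ μ' k' C') (hkk : ∀ x x', k' x x' = conj (k x' x))
    (g : Lp 𝕜 2 (μ.prod ν)) (w : Lp 𝕜 2 (μ'.prod ν)) :
    ⟪hk.op ν g, w⟫_𝕜 = ⟪g, hk'.op ν w⟫_𝕜 := by
  have hI := hk.integrable_conj_mul g w
  have hswap := measurePreserving_prod_swap_fst μ μ' ν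
  rw [L2.inner_def, L2.inner_def]
  calc ∫ z, ⟪hk.op ν g z, w z⟫_𝕜 ∂(μ'.prod ν)
      = ∫ z, ∫ x, conj (k z.1 x * g (x, z.2)) * w z ∂μ ∂(μ'.prod ν) := by
        refine integral_congr_ae ?_
        filter_upwards [hk.coeFn_op g] with z hz
        rw [hz, RCLike.inner_apply', kernelInt, ← integral_conj, integral_mul_const]
    _ = ∫ p, conj (k p.1.1 p.2 * g (p.2, p.1.2)) * w p.1 ∂((μ'.prod ν).prod μ) :=
        (integral_prod _ hI).symm
    _ = ∫ p, conj (k p.2 p.1.1 * g p.1) * w (p.2, p.1.2) ∂((μ.prod ν).prod μ') :=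
        (hswap.integral_comp measurableEmbedding_prod_swap_fst _).symm
    _ = ∫ z, ∫ x', conj (k x' z.1 * g z) * w (x', z.2) ∂μ' ∂(μ.prod ν) :=
        integral_prod _ (hswap.integrable_comp_of_integrable hI)
    _ = ∫ z, ⟪g z, hk'.op ν w z⟫_𝕜 ∂(μ.prod ν) := by
        refine integral_congr_ae ?_
        filter_upwards [hk'.coeFn_op w] with z hz
        rw [hz, RCLike.inner_apply', kernelInt, ← integral_const_mul]
        refine integral_congr_ae (.of_forall fun x' => ?_)
        simp only [hkk, map_mul]
        ring

theorem compMeasurePreserving_op [SFinite ν'] (hk : IsBoundedKernel μ' μ k C) {τ : Y → Y'}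
    (hτ : MeasurePreserving τ ν ν') (g : Lp 𝕜 2 (μ.prod ν')) :
    Lp.compMeasurePreserving _ ((MeasurePreserving.id μ').prod hτ) (hk.op ν' g) =
      hk.op ν (Lp.compMeasurePreserving _ ((MeasurePreserving.id μ).prod hτ) g) := by
  have hτ' := (MeasurePreserving.id μ').prod hτ
  refine Lp.ext ?_
  filter_upwards [Lp.coeFn_compMeasurePreserving (hk.op ν' g) hτ',
    hk.coeFn_op (Lp.compMeasurePreserving _ ((MeasurePreserving.id μ).prod hτ) g),
    hτ'.quasiMeasurePreserving.ae (hk.coeFn_op g), kernelInt_congr (μ' := μ') (k := k)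
      (Lp.coeFn_compMeasurePreserving g ((MeasurePreserving.id μ).prod hτ))]
    with z hleft hright hop hcomp
  rw [hleft, hright, hcomp, Function.comp_apply, hop]
  rfl

end IsBoundedKernel

end Kernels

section Pullback

variable {X Y Z : Type*} [MeasurableSpace X] [MeasurableSpace Y] [MeasurableSpace Z]
  {μ : Measure X} {ν : Measure Y} {ρ : Measure Z}

/-- Pullback of square-integrable functions along a measure preserving map. -/
abbrev pull {f : X → Y} (hf : MeasurePreserving f μ ν) : Lp ℂ 2 ν →ₗᵢ[ℂ] Lp ℂ 2 μ :=
  Lp.compMeasurePreservingₗᵢ ℂ f hf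

theorem coeFn_pull {f : X → Y} (hf : MeasurePreserving f μ ν) (g : Lp ℂ 2 ν) :
    pull hf g =ᵐ[μ] g ∘ f :=
  Lp.coeFn_compMeasurePreserving g hf

theorem pull_congr {f f' : X → Y} (hf : MeasurePreserving f μ ν) (hf' : MeasurePreserving f' μ ν)
    (h : ∀ x, f x = f' x) (g : Lp ℂ 2 ν) : pull hf g = pull hf' g := by
  obtain rfl : f = f' := funext h
  rfl

theorem pull_pull {f : Y → Z} {f' : X → Y} (hf : MeasurePreserving f ν ρ)
    (hf' : MeasurePreserving f' μ ν) (g : Lp ℂ 2 ρ) :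
    pull hf' (pull hf g) = pull (hf.comp hf') g :=
  (Lp.compMeasurePreserving_comp_apply g hf hf').symm

end Pullback

/-! ### Extracting particles -/

section Extraction

theorem sqrt_div_sqrt_mul (a b : ℝ) : √a / √b * b = √a * √b := by
  rw [div_mul_eq_mul_div, mul_div_assoc, Real.div_sqrt]

variable {D : ℕ} {m : ℝ}

theorem mem_NParticle_iff {n : ℕ} {g : Lp ℂ 2 (shellPi D m n)} :
    g ∈ NParticle D m n ↔ ∀ σ : Equiv.Perm (Fin n), pull (measurePreserving_perm D m n σ) g = g :=
  Iff.rfl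

/-- The ways to single out some of the `N` arguments of a wave function: `proj e` splits the
arguments into the singled out ones and the `n` remaining ones, `insert` puts the singled out
arguments in front of the others. -/
structure Extraction (D : ℕ) (m : ℝ) (N n : ℕ) {X : Type*} [MeasurableSpace X] (ρ : Measure X)
    (E : Type*) where
  proj : E → (Fin N → Momentum D) → X × (Fin n → Momentum D)
  insert : X × (Fin n → Momentum D) → Fin N → Momentum D
  measurePreserving_proj : ∀ e,
    MeasurePreserving (proj e) (shellPi D m N) (ρ.prod (shellPi D m n))
  measurePreserving_insert : MeasurePreserving insert (ρ.prod (shellPi D m n)) (shellPi D m N)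
  proj_perm : ∀ σ : Equiv.Perm (Fin N), ∃ s : Equiv.Perm E, ∀ e, ∃ τ : Equiv.Perm (Fin n),
    ∀ P, proj e (P ∘ σ) = Prod.map id (fun Q => Q ∘ τ) (proj (s e) P)
  insert_proj : ∀ e, ∃ σ : Equiv.Perm (Fin N), ∀ P, insert (proj e P) = P ∘ σ
  insert_perm : ∀ τ : Equiv.Perm (Fin n), ∃ σ : Equiv.Perm (Fin N),
    ∀ z, insert (Prod.map id (fun Q => Q ∘ τ) z) = insert z ∘ σ

theorem exists_perm_succAbove {n : ℕ} (σ : Equiv.Perm (Fin (n + 1))) (i : Fin (n + 1)) :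
    ∃ τ : Equiv.Perm (Fin n), ∀ l, σ (i.succAbove l) = (σ i).succAbove (τ l) := by
  have h : ∀ l, ∃ l', (σ i).succAbove l' = σ (i.succAbove l) := fun l =>
    Fin.exists_succAbove_eq fun h => Fin.succAbove_ne i l (σ.injective h)
  choose f hf using h
  have hinj : Function.Injective f := fun a b hab =>
    Fin.succAbove_right_injective (σ.injective (by rw [← hf a, ← hf b, hab]))
  exact ⟨Equiv.ofBijective f (Finite.injective_iff_bijective.mp hinj), fun l => (hf l).symm⟩

theorem exists_perm_cons {n : ℕ} (i : Fin (n + 1)) (f : Fin n → Fin (n + 1))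
    (hf : Function.Injective f) (hi : ∀ l, f l ≠ i) :
    ∃ σ : Equiv.Perm (Fin (n + 1)), σ 0 = i ∧ ∀ l : Fin n, σ l.succ = f l := by
  have hinj : Function.Injective (Fin.cons i f : Fin (n + 1) → Fin (n + 1)) := by
    rw [Fin.cons_injective_iff]
    exact ⟨fun ⟨l, hl⟩ => hi l hl, hf⟩
  exact ⟨Equiv.ofBijective _ (Finite.injective_iff_bijective.mp hinj), rfl, fun l => rfl⟩

/-- No argument is singled out. -/
def extractNone (D : ℕ) (m : ℝ) (n : ℕ) : Extraction D m n n (Measure.dirac ()) Unit where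
  proj _ P := ((), P)
  insert z := z.2
  measurePreserving_proj _ :=
    ⟨measurable_prodMk_left, (Measure.dirac_prod ()).symm⟩
  measurePreserving_insert := measurePreserving_snd
  proj_perm σ := ⟨1, fun _ => ⟨σ, fun _ => rfl⟩⟩
  insert_proj _ := ⟨1, fun _ => rfl⟩
  insert_perm τ := ⟨τ, fun _ => rfl⟩

/-- One argument is singled out. -/
def extractOne (D : ℕ) (m : ℝ) (n : ℕ) :
    Extraction D m (n + 1) n (shellMeasure D m) (Fin (n + 1)) where
  proj i P := (P i, fun l => P (i.succAbove l))
  insert z := Matrix.vecCons z.1 z.2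
  measurePreserving_proj i := measurePreserving_piFinSuccAbove (fun _ => shellMeasure D m) i
  measurePreserving_insert := by
    have h := (measurePreserving_piFinSuccAbove (fun _ => shellMeasure D m) (0 : Fin (n + 1))).symm
    convert h using 1
    funext z
    change Matrix.vecCons z.1 z.2 = Fin.insertNth 0 z.1 z.2
    rw [Fin.insertNth_zero]
    rfl
  proj_perm σ := by
    refine ⟨σ, fun i => ?_⟩
    obtain ⟨τ, hτ⟩ := exists_perm_succAbove σ i
    refine ⟨τ, fun P => Prod.ext rfl (funext fun l => ?_)⟩
    exact congrArg P (hτ l)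
  insert_proj i := by
    obtain ⟨σ, h0, hs⟩ := exists_perm_cons i i.succAbove Fin.succAbove_right_injective
      (fun l => Fin.succAbove_ne i l)
    refine ⟨σ, fun P => funext fun j => ?_⟩
    refine Fin.cases ?_ (fun l => ?_) j
    · exact congrArg P h0.symm
    · exact congrArg P (hs l).symm
  insert_perm τ := by
    obtain ⟨σ, h0, hs⟩ := exists_perm_cons 0 (fun l => (τ l).succ)
      ((Fin.succ_injective n).comp τ.injective) (fun l => Fin.succ_ne_zero _)
    refine ⟨σ, fun z => funext fun j => ?_⟩
    refine Fin.cases ?_ (fun l => ?_) j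
    · rw [Function.comp_apply, h0]; rfl
    · rw [Function.comp_apply, hs]; rfl

/-- Singling out arguments in two steps. -/
def Extraction.comp {N n n' : ℕ} {X X' E E' : Type*} [MeasurableSpace X] [MeasurableSpace X']
    {ρ : Measure X} {ρ' : Measure X'} [SFinite ρ] [SFinite ρ']
    (A : Extraction D m N n ρ E) (B : Extraction D m n n' ρ' E') :
    Extraction D m N n' (ρ.prod ρ') (E × E') where
  proj e P := (((A.proj e.1 P).1, (B.proj e.2 (A.proj e.1 P).2).1),
    (B.proj e.2 (A.proj e.1 P).2).2)
  insert z := A.insert (z.1.1, B.insert (z.1.2, z.2))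
  measurePreserving_proj e := by
    have h1 := (measurePreserving_prodAssoc ρ ρ' (shellPi D m n')).symm
    have h2 := (MeasurePreserving.id ρ).prod (B.measurePreserving_proj e.2)
    exact h1.comp (h2.comp (A.measurePreserving_proj e.1))
  measurePreserving_insert := by
    have h1 := measurePreserving_prodAssoc ρ ρ' (shellPi D m n')
    have h2 := (MeasurePreserving.id ρ).prod B.measurePreserving_insert
    exact A.measurePreserving_insert.comp (h2.comp h1)
  proj_perm σ := by
    obtain ⟨s, hs⟩ := A.proj_perm σ
    choose τ hτ using hs
    choose s' hs' using fun e => B.proj_perm (τ e)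
    refine ⟨Equiv.prodShear s s', fun e => ?_⟩
    obtain ⟨τ', hτ'⟩ := hs' e.1 e.2
    refine ⟨τ', fun P => ?_⟩
    simp only [hτ, Prod.map_fst, Prod.map_snd, hτ', id, Equiv.prodShear_apply]
    rfl
  insert_proj e := by
    obtain ⟨σ, hσ⟩ := A.insert_proj e.1
    obtain ⟨τ, hτ⟩ := B.insert_proj e.2
    obtain ⟨σ', hσ'⟩ := A.insert_perm τ
    refine ⟨σ * σ', fun P => ?_⟩
    have h := hσ' (A.proj e.1 P)
    rw [hσ] at h
    simp only [Prod.mk.eta, hτ]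
    exact h
  insert_perm τ := by
    obtain ⟨σ, hσ⟩ := B.insert_perm τ
    obtain ⟨σ', hσ'⟩ := A.insert_perm σ
    refine ⟨σ', fun z => ?_⟩
    rw [← hσ']
    have h := hσ (z.1.2, z.2)
    exact congrArg A.insert (Prod.ext rfl h)

/-- Two arguments are singled out. -/
def extractTwo (D : ℕ) (m : ℝ) (n : ℕ) :
    Extraction D m (n + 2) n ((shellMeasure D m).prod (shellMeasure D m))
      (Fin (n + 2) × Fin (n + 1)) :=
  (extractOne D m (n + 1)).comp (extractOne D m n)

namespace Extraction

variable {N N' n : ℕ} {X X' E E' : Type*} [MeasurableSpace X] [MeasurableSpace X']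
  {ρ : Measure X} {ρ' : Measure X'} (A : Extraction D m N n ρ E) (B : Extraction D m N' n ρ' E')

/-- Symmetry of a function of extracted and remaining arguments in the remaining ones. -/
def IsSymm [SFinite ρ] (W : Lp ℂ 2 (ρ.prod (shellPi D m n))) : Prop :=
  ∀ τ : Equiv.Perm (Fin n),
    pull ((MeasurePreserving.id ρ).prod (measurePreserving_perm D m n τ)) W = W

theorem isSymm_pull_insert [SFinite ρ] {g : Lp ℂ 2 (shellPi D m N)} (hg : g ∈ NParticle D m N) :
    IsSymm (pull A.measurePreserving_insert g) := by
  intro τ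
  obtain ⟨σ, hσ⟩ := A.insert_perm τ
  conv_rhs => rw [← mem_NParticle_iff.mp hg σ]
  rw [pull_pull, pull_pull]
  exact pull_congr _ _ hσ g

theorem isSymm_op [SFinite ρ] [SFinite ρ'] {k : X' → X → ℂ} {C : ℝ≥0}
    (hk : IsBoundedKernel ρ' ρ k C) {W : Lp ℂ 2 (ρ.prod (shellPi D m n))} (hW : IsSymm W) :
    IsSymm (hk.op (shellPi D m n) W) := fun τ =>
  (hk.compMeasurePreserving_op (measurePreserving_perm D m n τ) W).trans (congrArg _ (hW τ))

/-- The sum over all ways to extract arguments. -/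
def symm [Fintype E] : Lp ℂ 2 (ρ.prod (shellPi D m n)) →ₗ[ℂ] Lp ℂ 2 (shellPi D m N) :=
  ∑ e, (pull (A.measurePreserving_proj e)).toLinearMap

section symm

variable [Fintype E]

theorem symm_apply (W : Lp ℂ 2 (ρ.prod (shellPi D m n))) :
    A.symm W = ∑ e, pull (A.measurePreserving_proj e) W := by
  simp [symm]

theorem symm_mem_NParticle [SFinite ρ] {W : Lp ℂ 2 (ρ.prod (shellPi D m n))} (hW : IsSymm W) :
    A.symm W ∈ NParticle D m N := by
  rw [mem_NParticle_iff]
  intro σ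
  obtain ⟨s, hs⟩ := A.proj_perm σ
  have h (e : E) : pull (measurePreserving_perm D m N σ) (pull (A.measurePreserving_proj e) W) =
      pull (A.measurePreserving_proj (s e)) W := by
    obtain ⟨τ, hτ⟩ := hs e
    conv_rhs => rw [← hW τ]
    rw [pull_pull, pull_pull]
    exact pull_congr _ _ hτ W
  simp_rw [symm_apply, map_sum, h]
  exact Equiv.sum_comp s fun e => pull (A.measurePreserving_proj e) W

theorem norm_symm_le (W : Lp ℂ 2 (ρ.prod (shellPi D m n))) :
    ‖A.symm W‖ ≤ Fintype.card E * ‖W‖ := by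
  rw [symm_apply]
  exact (norm_sum_le _ _).trans (by simp)

theorem inner_symm_left (W : Lp ℂ 2 (ρ.prod (shellPi D m n))) {g : Lp ℂ 2 (shellPi D m N)}
    (hg : g ∈ NParticle D m N) :
    ⟪A.symm W, g⟫_ℂ = Fintype.card E * ⟪W, pull A.measurePreserving_insert g⟫_ℂ := by
  have h (e : E) : ⟪pull (A.measurePreserving_proj e) W, g⟫_ℂ =
      ⟪W, pull A.measurePreserving_insert g⟫_ℂ := by
    obtain ⟨σ, hσ⟩ := A.insert_proj e
    have hproj : pull (A.measurePreserving_proj e) (pull A.measurePreserving_insert g) = g := by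
      conv_rhs => rw [← mem_NParticle_iff.mp hg σ]
      rw [pull_pull]
      exact pull_congr _ _ hσ g
    conv_lhs => rw [← hproj]
    exact LinearIsometry.inner_map_map _ _ _
  simp [symm_apply, sum_inner, h]

end symm

variable [SFinite ρ] [SFinite ρ'] {k : X' → X → ℂ} {C : ℝ≥0}

theorem ae_integrable_kernel_mul (hk : IsBoundedKernel ρ' ρ k C) (g : Lp ℂ 2 (shellPi D m N))
    (e : E') : ∀ᵐ P ∂(shellPi D m N'),
      Integrable (fun x => k (B.proj e P).1 x * g (A.insert (x, (B.proj e P).2))) ρ := by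
  have hproj := (B.measurePreserving_proj e).quasiMeasurePreserving
  have hpull := (Measure.quasiMeasurePreserving_snd (μ := ρ') (ν := shellPi D m n)).ae
    (ae_ae_swap (coeFn_pull A.measurePreserving_insert g))
  filter_upwards [hproj.ae (hk.ae_integrable (pull A.measurePreserving_insert g)),
    hproj.ae hpull] with P hint hP
  refine hint.congr ?_
  filter_upwards [hP] with x hx
  rw [hx, Function.comp_apply]

theorem coeFn_pull_proj_op (hk : IsBoundedKernel ρ' ρ k C) (g : Lp ℂ 2 (shellPi D m N)) (e : E') :
    pull (B.measurePreserving_proj e) (hk.op _ (pull A.measurePreserving_insert g))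
      =ᵐ[shellPi D m N'] fun P =>
        ∫ x, k (B.proj e P).1 x * g (A.insert (x, (B.proj e P).2)) ∂ρ := by
  have hproj := (B.measurePreserving_proj e).quasiMeasurePreserving
  filter_upwards [coeFn_pull (B.measurePreserving_proj e) _,
    hproj.ae (hk.coeFn_op (pull A.measurePreserving_insert g)),
    hproj.ae (kernelInt_congr (μ' := ρ') (k := k) (coeFn_pull A.measurePreserving_insert g))]
    with P hpull hop hcongr
  rw [hpull, Function.comp_apply, hop, hcongr]
  rfl

theorem coeFn_symm_op [Fintype E'] (hk : IsBoundedKernel ρ' ρ k C)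
    (g : Lp ℂ 2 (shellPi D m N)) :
    B.symm (hk.op _ (pull A.measurePreserving_insert g)) =ᵐ[shellPi D m N'] fun P =>
      ∑ e, ∫ x, k (B.proj e P).1 x * g (A.insert (x, (B.proj e P).2)) ∂ρ := by
  rw [symm_apply]
  filter_upwards [Lp.coeFn_finsetSum (p := 2) (μ := shellPi D m N') Finset.univ
      fun e => pull (B.measurePreserving_proj e) (hk.op _ (pull A.measurePreserving_insert g)),
    ae_all_iff.mpr (A.coeFn_pull_proj_op B hk g)] with P hsum hP
  rw [hsum, Finset.sum_apply]
  exact Finset.sum_congr rfl fun e _ => hP e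

variable [Fintype E] [Fintype E']

/-- The operator from `N`-particle to `N'`-particle vectors that annihilates the particles extracted
by `A` and creates those extracted by `B`, with amplitude `k`: the Wick monomial
`∫∫ k(x', x) a†(x') a(x) dρ(x') dρ(x)`. The factor is the usual normalization, since the number of
extractions of `r` out of `N` particles is `N (N - 1) ⋯ (N - r + 1)`. -/
def wickOp (hk : IsBoundedKernel ρ' ρ k C) : NParticle D m N →ₗ[ℂ] NParticle D m N' :=
  ((√(Fintype.card E) / √(Fintype.card E') : ℝ) : ℂ) •
    (B.symm ∘ₗ (hk.op _).toLinearMap ∘ₗ (pull A.measurePreserving_insert).toLinearMap ∘ₗ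
      (NParticle D m N).subtype).codRestrict (NParticle D m N') fun g =>
        B.symm_mem_NParticle (isSymm_op hk (A.isSymm_pull_insert g.2))

theorem coe_wickOp (hk : IsBoundedKernel ρ' ρ k C) (g : NParticle D m N) :
    (A.wickOp B hk g : Lp ℂ 2 (shellPi D m N')) =
      ((√(Fintype.card E) / √(Fintype.card E') : ℝ) : ℂ) •
        B.symm (hk.op _ (pull A.measurePreserving_insert (g : Lp ℂ 2 (shellPi D m N)))) :=
  rfl

theorem coeFn_wickOp (hk : IsBoundedKernel ρ' ρ k C) (g : NParticle D m N) :
    (A.wickOp B hk g : Lp ℂ 2 (shellPi D m N')) =ᵐ[shellPi D m N'] fun P =>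
      ((√(Fintype.card E) / √(Fintype.card E') : ℝ) : ℂ) * ∑ e, ∫ x, k (B.proj e P).1 x *
        (g : Lp ℂ 2 (shellPi D m N)) (A.insert (x, (B.proj e P).2)) ∂ρ := by
  rw [coe_wickOp]
  filter_upwards [Lp.coeFn_smul ((√(Fintype.card E) / √(Fintype.card E') : ℝ) : ℂ)
    (B.symm (hk.op _ (pull A.measurePreserving_insert (g : Lp ℂ 2 (shellPi D m N))))),
    A.coeFn_symm_op B hk g] with P hsmul hP
  rw [hsmul, Pi.smul_apply, hP, smul_eq_mul]

theorem norm_wickOp_le (hk : IsBoundedKernel ρ' ρ k C) (g : NParticle D m N) :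
    ‖A.wickOp B hk g‖ ≤ √(Fintype.card E) * √(Fintype.card E') * C * ‖g‖ := by
  have hop := hk.norm_op_apply_le (pull A.measurePreserving_insert (g : Lp ℂ 2 (shellPi D m N)))
  rw [LinearIsometry.norm_map] at hop
  rw [Submodule.coe_norm, coe_wickOp, norm_smul, Complex.norm_of_nonneg (by positivity)]
  calc √(Fintype.card E) / √(Fintype.card E') * ‖B.symm _‖
      ≤ √(Fintype.card E) / √(Fintype.card E') * (Fintype.card E' * (C * ‖g‖)) := by
        gcongr
        exact (B.norm_symm_le _).trans (by gcongr; exact hop)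
    _ = √(Fintype.card E) * √(Fintype.card E') * C * ‖g‖ := by
        rw [← mul_assoc, sqrt_div_sqrt_mul]
        ring

theorem inner_wickOp_left {k' : X → X' → ℂ} {C' : ℝ≥0} (hk : IsBoundedKernel ρ' ρ k C)
    (hk' : IsBoundedKernel ρ ρ' k' C') (hkk : ∀ x x', k' x x' = conj (k x' x))
    (g : NParticle D m N) (w : NParticle D m N') :
    ⟪A.wickOp B hk g, w⟫_ℂ = ⟪g, B.wickOp A hk' w⟫_ℂ := by
  have hright (W : Lp ℂ 2 (ρ.prod (shellPi D m n))) :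
      ⟪(g : Lp ℂ 2 (shellPi D m N)), A.symm W⟫_ℂ =
        Fintype.card E * ⟪pull A.measurePreserving_insert (g : Lp ℂ 2 (shellPi D m N)), W⟫_ℂ := by
    rw [← inner_conj_symm, A.inner_symm_left W g.2, map_mul, inner_conj_symm, Complex.conj_natCast]
  have hcoeff (a b : ℕ) : ((√a / √b : ℝ) : ℂ) * b = ((√a * √b : ℝ) : ℂ) := by
    rw [← sqrt_div_sqrt_mul, Complex.ofReal_mul, Complex.ofReal_natCast]
  rw [Submodule.coe_inner, Submodule.coe_inner, coe_wickOp, coe_wickOp, inner_smul_left,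
    inner_smul_right, Complex.conj_ofReal, B.inner_symm_left _ w.2, hright,
    hk.inner_op_left hk' hkk, ← mul_assoc, ← mul_assoc, hcoeff, hcoeff, mul_comm (√_)]

end Extraction

end Extraction

/-! ### Operators that change the particle number by a constant -/

section Shift

section shiftFun

variable {R : Type*} [Semiring R] {V : ℕ → Type*} [∀ n, AddCommMonoid (V n)] [∀ n, Module R (V n)]
  {r s : ℕ}

/-- The linear map on sequences that moves the entry with index `n + s` to the index `n + r`,
applying `O n`, and sets the entries with index below `r` to zero. -/
def shiftFun (O : ∀ n, V (n + s) →ₗ[R] V (n + r)) : (∀ n, V n) →ₗ[R] ∀ n, V n :=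
  LinearMap.pi fun j => if h : r ≤ j then
    (Nat.sub_add_cancel h ▸ (O (j - r) ∘ₗ LinearMap.proj (j - r + s)) : (∀ n, V n) →ₗ[R] V j) else 0

theorem shiftFun_apply_add (O : ∀ n, V (n + s) →ₗ[R] V (n + r)) (x : ∀ n, V n) (n : ℕ) :
    shiftFun O x (n + r) = O n (x (n + s)) := by
  have transport (n' : ℕ) (e : n' + r = n + r) :
      (e ▸ (O n' ∘ₗ LinearMap.proj (n' + s)) : (∀ n, V n) →ₗ[R] V (n + r)) x = O n (x (n + s)) := by
    obtain rfl : n' = n := by omega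
    rfl
  rw [shiftFun, LinearMap.pi_apply, dif_pos (Nat.le_add_left r n)]
  exact transport _ _

theorem shiftFun_apply_of_lt (O : ∀ n, V (n + s) →ₗ[R] V (n + r)) (x : ∀ n, V n) {j : ℕ}
    (hj : j < r) : shiftFun O x j = 0 := by
  rw [shiftFun, LinearMap.pi_apply, dif_neg hj.not_ge]
  rfl

theorem shiftFun_eq_zero (O : ∀ n, V (n + s) →ₗ[R] V (n + r)) {x : ∀ n, V n} {N : ℕ}
    (h : ∀ l, N < l → x l = 0) {l : ℕ} (hl : N + r < l) : shiftFun O x l = 0 := by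
  obtain ⟨n, rfl⟩ : ∃ n, l = n + r := ⟨l - r, by omega⟩
  rw [shiftFun_apply_add, h _ (by omega), map_zero]

end shiftFun

theorem memℓp_of_forall_lt_eq_zero {V : ℕ → Type*} [∀ n, NormedAddCommGroup (V n)]
    {x : ∀ n, V n} {N : ℕ} (h : ∀ l, N < l → x l = 0) (p : ℝ≥0∞) : Memℓp x p := by
  refine (memℓp_zero ((Set.finite_Iic N).subset fun l hl => ?_)).of_exponent_ge zero_le
  exact not_lt.mp fun hN => hl (h l hN)

theorem le_mul_of_hasSum_shift {a b : ℕ → ℝ} {x y c : ℝ} {r s : ℕ} (ha : HasSum a x)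
    (hb : HasSum b y) (hc : 0 ≤ c) (hb0 : ∀ n, 0 ≤ b n) (ha0 : ∀ j, j < r → a j = 0)
    (h : ∀ n, a (n + r) ≤ c * b (n + s)) : x ≤ c * y := by
  rw [← ha.tsum_eq, ← hb.tsum_eq, ← ha.summable.sum_add_tsum_nat_add r,
    Finset.sum_eq_zero fun j hj => ha0 j (Finset.mem_range.mp hj), zero_add]
  calc ∑' n, a (n + r) ≤ ∑' n, c * b (n + s) :=
        Summable.tsum_le_tsum h ((summable_nat_add_iff r).mpr ha.summable)
          (((summable_nat_add_iff s).mpr hb.summable).mul_left _)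
    _ = c * ∑' n, b (n + s) := tsum_mul_left
    _ ≤ c * ∑' n, b n := by
        refine mul_le_mul_of_nonneg_left ?_ hc
        rw [← hb.summable.sum_add_tsum_nat_add s]
        exact le_add_of_nonneg_left (Finset.sum_nonneg fun _ _ => hb0 _)

theorem lp_hasSum_norm_sq {ι : Type*} {V : ι → Type*} [∀ i, NormedAddCommGroup (V i)]
    (x : lp V 2) : HasSum (fun i => ‖x i‖ ^ 2) (‖x‖ ^ 2) := by
  have h := lp.hasSum_norm (p := 2) (by norm_num) x
  rw [show (2 : ℝ≥0∞).toReal = ((2 : ℕ) : ℝ) by norm_num] at h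
  simpa only [Real.rpow_natCast] using h

variable {D : ℕ} {m : ℝ} {r s : ℕ}

theorem dense_finiteParticle (D : ℕ) (m : ℝ) : Dense (FiniteParticle D m : Set (Fock D m)) := by
  intro ψ
  have h := lp.hasSum_single (p := 2) (by norm_num) ψ
  refine mem_closure_of_tendsto h (Filter.Eventually.of_forall fun s => ?_)
  refine Submodule.sum_mem _ fun n _ => ⟨n, fun l hl => ?_⟩
  exact lp.single_apply_ne 2 n _ hl.ne'

theorem exists_shiftFun_eq_zero (O : ∀ n, NParticle D m (n + s) →ₗ[ℂ] NParticle D m (n + r))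
    (ψ : FiniteParticle D m) :
    ∃ N, ∀ l, N < l → shiftFun (V := fun n => NParticle D m n) O ⇑(ψ : Fock D m) l = 0 := by
  obtain ⟨N, hN⟩ := ψ.2
  exact ⟨N + r, fun l hl => shiftFun_eq_zero (V := fun n => NParticle D m n) O hN hl⟩

/-- The operator on `F₀` that removes `s` particles and adds `r` particles, acting as `O n` on the
component with `n + s` particles. -/
def shiftOp (O : ∀ n, NParticle D m (n + s) →ₗ[ℂ] NParticle D m (n + r)) :
    Module.End ℂ (FiniteParticle D m) where
  toFun ψ :=
    ⟨⟨_, (exists_shiftFun_eq_zero O ψ).elim fun _ h => memℓp_of_forall_lt_eq_zero h 2⟩,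
      exists_shiftFun_eq_zero O ψ⟩
  map_add' ψ φ := by
    ext1
    ext1
    exact (shiftFun (V := fun n => NParticle D m n) O).map_add ⇑(ψ : Fock D m) ⇑(φ : Fock D m)
  map_smul' c ψ := by
    ext1
    ext1
    exact (shiftFun (V := fun n => NParticle D m n) O).map_smul c ⇑(ψ : Fock D m)

variable (O : ∀ n, NParticle D m (n + s) →ₗ[ℂ] NParticle D m (n + r))

theorem shiftOp_apply_add (ψ : FiniteParticle D m) (n : ℕ) :
    (shiftOp O ψ : Fock D m) (n + r) = O n ((ψ : Fock D m) (n + s)) :=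
  shiftFun_apply_add (V := fun n => NParticle D m n) O _ n

theorem shiftOp_apply_of_lt (ψ : FiniteParticle D m) {j : ℕ} (hj : j < r) :
    (shiftOp O ψ : Fock D m) j = 0 :=
  shiftFun_apply_of_lt (V := fun n => NParticle D m n) O _ hj

theorem atMost_shiftOp {ψ : FiniteParticle D m} {N : ℕ} (hψ : AtMost N (ψ : Fock D m)) :
    AtMost (N + r) (shiftOp O ψ : Fock D m) :=
  fun _ => shiftFun_eq_zero O hψ

theorem norm_shiftOp_apply_le {ψ : FiniteParticle D m} {N : ℕ} (hψ : AtMost N (ψ : Fock D m))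
    {C : ℝ} (hC : 0 ≤ C) (hO : ∀ n x, n + s ≤ N → ‖O n x‖ ≤ C * ‖x‖) :
    ‖shiftOp O ψ‖ ≤ C * ‖ψ‖ := by
  have hterm (n : ℕ) :
      ‖(shiftOp O ψ : Fock D m) (n + r)‖ ^ 2 ≤ C ^ 2 * ‖(ψ : Fock D m) (n + s)‖ ^ 2 := by
    rw [shiftOp_apply_add, ← mul_pow]
    by_cases h : n + s ≤ N
    · gcongr
      exact hO n _ h
    · rw [hψ _ (by omega), map_zero]
      simp
  have hsq : ‖(shiftOp O ψ : Fock D m)‖ ^ 2 ≤ C ^ 2 * ‖(ψ : Fock D m)‖ ^ 2 :=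
    le_mul_of_hasSum_shift (lp_hasSum_norm_sq _) (lp_hasSum_norm_sq _) (sq_nonneg C)
      (fun _ => sq_nonneg _) (fun j hj => by rw [shiftOp_apply_of_lt O ψ hj]; simp) hterm
  rw [← mul_pow] at hsq
  exact (sq_le_sq₀ (norm_nonneg _) (mul_nonneg hC (norm_nonneg _))).mp hsq

theorem inner_shiftOp_left (O' : ∀ n, NParticle D m (n + r) →ₗ[ℂ] NParticle D m (n + s))
    (hO : ∀ n x y, ⟪O n x, y⟫_ℂ = ⟪x, O' n y⟫_ℂ) (ψ φ : FiniteParticle D m) :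
    ⟪shiftOp O ψ, φ⟫_ℂ = ⟪ψ, shiftOp O' φ⟫_ℂ := by
  have hleft := lp.hasSum_inner (𝕜 := ℂ) (shiftOp O ψ : Fock D m) (φ : Fock D m)
  have hright := lp.hasSum_inner (𝕜 := ℂ) (ψ : Fock D m) (shiftOp O' φ : Fock D m)
  rw [Submodule.coe_inner, Submodule.coe_inner, ← hleft.tsum_eq, ← hright.tsum_eq,
    ← hleft.summable.sum_add_tsum_nat_add r, ← hright.summable.sum_add_tsum_nat_add s,
    Finset.sum_eq_zero, Finset.sum_eq_zero]
  · simp only [shiftOp_apply_add, hO]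
  · intro j hj
    rw [shiftOp_apply_of_lt O' φ (Finset.mem_range.mp hj), inner_zero_right]
  · intro j hj
    rw [shiftOp_apply_of_lt O ψ (Finset.mem_range.mp hj), inner_zero_left]

end Shift

/-! ### Bounds that are linear in the particle number -/

section StepBound

variable {D : ℕ} {m : ℝ} {T S : Module.End ℂ (FiniteParticle D m)} {K L : ℝ}

/-- `T` adds at most two particles and its norm on vectors with at most `N` particles is at most
`(N + 1) K`. -/
structure StepBound (T : Module.End ℂ (FiniteParticle D m)) (K : ℝ) : Prop where
  atMost : ∀ (N : ℕ) (ψ : FiniteParticle D m), AtMost N (ψ : Fock D m) →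
    AtMost (N + 2) (T ψ : Fock D m)
  norm_le : ∀ (N : ℕ) (ψ : FiniteParticle D m), AtMost N (ψ : Fock D m) →
    ‖T ψ‖ ≤ (N + 1) * K * ‖ψ‖

theorem StepBound.add (hT : StepBound T K) (hS : StepBound S L) : StepBound (T + S) (K + L) where
  atMost N ψ h l hl := by
    change (T ψ : Fock D m) l + (S ψ : Fock D m) l = 0
    rw [hT.atMost N ψ h l hl, hS.atMost N ψ h l hl, add_zero]
  norm_le N ψ h := by
    refine (norm_add_le _ _).trans ((add_le_add (hT.norm_le N ψ h) (hS.norm_le N ψ h)).trans_eq ?_)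
    ring

theorem StepBound.smul (hT : StepBound T K) (c : ℂ) : StepBound (c • T) (‖c‖ * K) where
  atMost N ψ h l hl := by
    change c • (T ψ : Fock D m) l = 0
    rw [hT.atMost N ψ h l hl, smul_zero]
  norm_le N ψ h := by
    rw [LinearMap.smul_apply, norm_smul]
    calc ‖c‖ * ‖T ψ‖ ≤ ‖c‖ * ((N + 1) * K * ‖ψ‖) := by gcongr; exact hT.norm_le N ψ h
      _ = (N + 1) * (‖c‖ * K) * ‖ψ‖ := by ring

theorem StepBound.mono (hT : StepBound T K) (h : K ≤ L) : StepBound T L where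
  atMost := hT.atMost
  norm_le N ψ hψ := (hT.norm_le N ψ hψ).trans (by gcongr)

theorem stepBound_shiftOp {r s : ℕ} {O : ∀ n, NParticle D m (n + s) →ₗ[ℂ] NParticle D m (n + r)}
    (hr : r ≤ 2) (hK : 0 ≤ K) {c : ℕ → ℝ} (hO : ∀ n x, ‖O n x‖ ≤ c n * ‖x‖)
    (hc : ∀ n, c n ≤ (n + s + 1) * K) : StepBound (shiftOp O) K where
  atMost _ _ h _ hl := atMost_shiftOp O h _ (by omega)
  norm_le N ψ h := norm_shiftOp_apply_le O h (by positivity) fun n x hn => by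
    have hn' : (n : ℝ) + s ≤ N := by exact_mod_cast hn
    refine (hO n x).trans (mul_le_mul_of_nonneg_right ((hc n).trans ?_) (norm_nonneg _))
    gcongr

theorem Gamma_natCast_succ_add (k : ℕ) {a : ℝ} (ha : 0 < a) :
    Real.Gamma ((k + 1 : ℕ) + a) = (k + a) * Real.Gamma (k + a) := by
  have hka : (k : ℝ) + a ≠ 0 := by positivity
  rw [← Real.Gamma_add_one hka, Nat.cast_succ, add_right_comm]

theorem StepBound.atMost_list_prod {k : ℕ} {T : Fin k → Module.End ℂ (FiniteParticle D m)}
    {K : Fin k → ℝ} (hT : ∀ j, StepBound (T j) (K j)) {n : ℕ} {ψ : FiniteParticle D m}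
    (hψ : AtMost n (ψ : Fock D m)) : AtMost (n + 2 * k) ((List.ofFn T).prod ψ : Fock D m) := by
  induction k with
  | zero => simpa using hψ
  | succ k ih =>
    rw [List.ofFn_succ, List.prod_cons, Module.End.mul_apply]
    exact fun l hl => (hT 0).atMost _ _ (ih fun j => hT j.succ) l (by omega)

/-- The `j`-th factor from the right acts on at most `n + 2 (j - 1)` particles, so that the bounds
multiply to `∏ 2 (j - 1 + (n + 1) / 2) K_j`, a quotient of Gamma functions. -/
theorem StepBound.norm_list_prod_le {k : ℕ} {T : Fin k → Module.End ℂ (FiniteParticle D m)}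
    {K : Fin k → ℝ} (hK : ∀ j, 0 ≤ K j) (hT : ∀ j, StepBound (T j) (K j)) {n : ℕ}
    {ψ : FiniteParticle D m} (hψ : AtMost n (ψ : Fock D m)) :
    ‖(List.ofFn T).prod ψ‖ ≤ 2 ^ k * Real.Gamma (k + ((n : ℝ) + 1) / 2) /
      Real.Gamma (((n : ℝ) + 1) / 2) * (∏ j, K j) * ‖ψ‖ := by
  set a : ℝ := ((n : ℝ) + 1) / 2 with ha_def
  have ha : 0 < a := by positivity
  have hGamma : 0 < Real.Gamma a := Real.Gamma_pos_of_pos ha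
  induction k with
  | zero => simp [hGamma.ne']
  | succ k ih =>
    have hK0 := hK 0
    rw [List.ofFn_succ, List.prod_cons, Module.End.mul_apply]
    calc _ ≤ (((n + 2 * k : ℕ) : ℝ) + 1) * K 0 * ‖(List.ofFn fun j : Fin k => T j.succ).prod ψ‖ :=
          (hT 0).norm_le _ _ (atMost_list_prod (fun j => hT j.succ) hψ)
      _ ≤ (2 * (k + a)) * K 0 * (2 ^ k * Real.Gamma (k + a) / Real.Gamma a *
            (∏ j : Fin k, K j.succ) * ‖ψ‖) := by
          gcongr
          · rw [ha_def]
            push_cast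
            linarith
          · exact ih (fun j => hK j.succ) fun j => hT j.succ
      _ = 2 ^ (k + 1) * Real.Gamma ((k + 1 : ℕ) + a) / Real.Gamma a * (∏ j, K j) * ‖ψ‖ := by
          rw [Gamma_natCast_succ_add k ha, Fin.prod_univ_succ]
          ring

theorem summable_pow_mul_Gamma_div_factorial {a x : ℝ} (ha : 0 < a) (hx : 0 < x) (hx1 : x < 1) :
    Summable fun k : ℕ => x ^ k * (Real.Gamma (k + a) / k.factorial) := by
  have hGamma (k : ℕ) : 0 < Real.Gamma (k + a) := Real.Gamma_pos_of_pos (by positivity)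
  have hpos (k : ℕ) : 0 < x ^ k * (Real.Gamma (k + a) / k.factorial) := by
    have := hGamma k
    positivity
  refine summable_of_ratio_test_tendsto_lt_one hx1 (Filter.Eventually.of_forall fun k =>
    (hpos k).ne') ?_
  have hlim : Filter.Tendsto (fun k : ℕ => x + x * (a - 1) * (1 / ((k : ℝ) + 1))) Filter.atTop
      (nhds x) := by
    simpa using (tendsto_one_div_add_atTop_nhds_zero_nat.const_mul (x * (a - 1))).const_add x
  refine hlim.congr fun k => ?_
  have hfact : (k.factorial : ℝ) ≠ 0 := by exact_mod_cast k.factorial_ne_zero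
  have := hGamma k
  rw [Real.norm_of_nonneg (hpos _).le, Real.norm_of_nonneg (hpos _).le,
    Gamma_natCast_succ_add k ha, Nat.factorial_succ, pow_succ]
  push_cast
  field_simp
  ring

theorem StepBound.summable_norm_pow_apply (hK : 0 < K) (hT : StepBound T K)
    (ψ : FiniteParticle D m) :
    Summable fun k : ℕ => (1 / (4 * K)) ^ k / k.factorial * ‖(T ^ k) ψ‖ := by
  obtain ⟨n, hn⟩ := ψ.2
  set a : ℝ := ((n : ℝ) + 1) / 2
  have ha : 0 < a := by positivity
  have hpow (k : ℕ) :
      ‖(T ^ k) ψ‖ ≤ 2 ^ k * Real.Gamma (k + a) / Real.Gamma a * K ^ k * ‖ψ‖ := by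
    simpa [List.ofFn_const] using norm_list_prod_le (k := k) (T := fun _ => T) (K := fun _ => K)
      (fun _ => hK.le) (fun _ => hT) hn
  refine Summable.of_nonneg_of_le (fun k => by positivity) (fun k => ?_)
    ((summable_pow_mul_Gamma_div_factorial ha one_half_pos one_half_lt_one).mul_right
      (‖ψ‖ / Real.Gamma a))
  calc (1 / (4 * K)) ^ k / k.factorial * ‖(T ^ k) ψ‖
      ≤ (1 / (4 * K)) ^ k / k.factorial *
        (2 ^ k * Real.Gamma (k + a) / Real.Gamma a * K ^ k * ‖ψ‖) := by
        gcongr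
        exact hpow k
    _ = (1 / (4 * K) * 2 * K) ^ k * (Real.Gamma (k + a) / k.factorial) *
        (‖ψ‖ / Real.Gamma a) := by
        rw [mul_pow, mul_pow]
        ring
    _ = (1 / 2) ^ k * (Real.Gamma (k + a) / k.factorial) * (‖ψ‖ / Real.Gamma a) := by
        congr 3
        field_simp
        norm_num

theorem StepBound.isEssentiallySelfAdjoint (hK : 0 < K) (hT : StepBound T K)
    (hsymm : LinearMap.IsSymmetric (𝕜 := ℂ) (E := FiniteParticle D m) T) :
    IsEssentiallySelfAdjoint (toPMap T) := by
  have hF := dense_finiteParticle D m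
  have hdeficiency {z : ℂ} (hz : conj z = -z) (hz' : ‖z‖ = 1) (φ : Fock D m)
      (hφ : ∀ ψ : FiniteParticle D m, ⟪φ, T ψ⟫_ℂ = z * ⟪φ, ψ⟫_ℂ) : φ = 0 :=
    eq_zero_of_inner_eq_mul_inner hF hsymm (by positivity) (hT.summable_norm_pow_apply hK) hz hz' hφ
  refine isEssentiallySelfAdjoint_of_deficiency hF (fun ψ φ => hsymm ψ φ) ?_ ?_
  · exact hdeficiency Complex.conj_I Complex.norm_I
  · exact hdeficiency (by simp) (by simp)

end StepBound

/-! ### Wick monomials -/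

section WickMonomials

variable {D : ℕ} {m : ℝ} {C : ℝ≥0}

section wickEnd

variable {X X' : Type*} [MeasurableSpace X] [MeasurableSpace X'] {ρ : Measure X} {ρ' : Measure X'}
  [SFinite ρ] [SFinite ρ'] {E E' : ℕ → Type*} [∀ n, Fintype (E n)] [∀ n, Fintype (E' n)] {r s : ℕ}
  (A : ∀ n, Extraction D m (n + s) n ρ (E n)) (B : ∀ n, Extraction D m (n + r) n ρ' (E' n))
  {k : X' → X → ℂ}

/-- The Wick monomial `∫∫ k(x', x) a†(x') a(x) dρ(x') dρ(x)` on `F₀`, where `a(x)` annihilates `s`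
particles and `a†(x')` creates `r` particles. -/
def wickEnd (hk : IsBoundedKernel ρ' ρ k C) : Module.End ℂ (FiniteParticle D m) :=
  shiftOp fun n => (A n).wickOp (B n) hk

theorem wave_wickEnd_add (hk : IsBoundedKernel ρ' ρ k C) (ψ : FiniteParticle D m) (n : ℕ) :
    wave (wickEnd A B hk ψ : Fock D m) (n + r) =ᵐ[shellPi D m (n + r)] fun P =>
      ((√(Fintype.card (E n)) / √(Fintype.card (E' n)) : ℝ) : ℂ) *
        ∑ e, ∫ x, k ((B n).proj e P).1 x *
          wave (ψ : Fock D m) (n + s) ((A n).insert (x, ((B n).proj e P).2)) ∂ρ := by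
  rw [wave, wickEnd, shiftOp_apply_add]
  exact (A n).coeFn_wickOp (B n) hk _

theorem wave_wickEnd_of_lt (hk : IsBoundedKernel ρ' ρ k C) (ψ : FiniteParticle D m) {j : ℕ}
    (hj : j < r) : wave (wickEnd A B hk ψ : Fock D m) j =ᵐ[shellPi D m j] 0 := by
  rw [wave, wickEnd, shiftOp_apply_of_lt _ ψ hj]
  exact Lp.coeFn_zero _ _ _

theorem inner_wickEnd_left {k' : X → X' → ℂ} {C' : ℝ≥0} (hk : IsBoundedKernel ρ' ρ k C)
    (hk' : IsBoundedKernel ρ ρ' k' C') (hkk : ∀ x x', k' x x' = conj (k x' x))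
    (ψ φ : FiniteParticle D m) : ⟪wickEnd A B hk ψ, φ⟫_ℂ = ⟪ψ, wickEnd B A hk' φ⟫_ℂ :=
  inner_shiftOp_left _ _ (fun n => (A n).inner_wickOp_left (B n) hk hk' hkk) ψ φ

theorem stepBound_wickEnd (hk : IsBoundedKernel ρ' ρ k C) (hr : r ≤ 2) {c : ℝ} (hc : 0 ≤ c)
    (hcard : ∀ n, √(Fintype.card (E n)) * √(Fintype.card (E' n)) ≤ (n + s + 1) * c) :
    StepBound (wickEnd A B hk) (c * C) :=
  stepBound_shiftOp hr (by positivity) (fun n => (A n).norm_wickOp_le (B n) hk) fun n => by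
    rw [← mul_assoc]
    exact mul_le_mul_of_nonneg_right (hcard n) C.2

end wickEnd

theorem isBoundedKernel_row {X : Type*} [MeasurableSpace X] {ρ : Measure X} [SFinite ρ] {u : X → ℂ}
    (hu : StronglyMeasurable u) (hC : ∫⁻ x, ‖u x‖ₑ ^ 2 ∂ρ ≤ (C : ℝ≥0∞) ^ 2) :
    IsBoundedKernel (Measure.dirac ()) ρ (fun _ => u) C :=
  .of_hilbertSchmidt (hu.comp_measurable measurable_snd) (by simpa using hC)

theorem isBoundedKernel_column {X : Type*} [MeasurableSpace X] {ρ : Measure X} [SFinite ρ]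
    {u : X → ℂ} (hu : StronglyMeasurable u) (hC : ∫⁻ x, ‖u x‖ₑ ^ 2 ∂ρ ≤ (C : ℝ≥0∞) ^ 2) :
    IsBoundedKernel ρ (Measure.dirac ()) (fun x _ => u x) C :=
  .of_hilbertSchmidt (hu.comp_measurable measurable_fst) (by simpa using hC)

/-- The smeared annihilation operator `∫ u(p) a(p) dμ(p)`. -/
def annOp {u : Momentum D → ℂ}
    (hk : IsBoundedKernel (Measure.dirac ()) (shellMeasure D m) (fun _ => u) C) :
    Module.End ℂ (FiniteParticle D m) :=
  wickEnd (r := 0) (s := 1) (extractOne D m) (extractNone D m) hk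

/-- The smeared creation operator `∫ u(p) a†(p) dμ(p)`. -/
def creOp {u : Momentum D → ℂ}
    (hk : IsBoundedKernel (shellMeasure D m) (Measure.dirac ()) (fun x _ => u x) C) :
    Module.End ℂ (FiniteParticle D m) :=
  wickEnd (r := 1) (s := 0) (extractNone D m) (extractOne D m) hk

theorem wave_annOp {u : Momentum D → ℂ}
    (hk : IsBoundedKernel (Measure.dirac ()) (shellMeasure D m) (fun _ => u) C)
    (ψ : FiniteParticle D m) (n : ℕ) :
    wave (annOp hk ψ : Fock D m) n =ᵐ[shellPi D m n] annTerm u (ψ : Fock D m) n := by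
  filter_upwards [wave_wickEnd_add (r := 0) (s := 1) (extractOne D m) (extractNone D m) hk ψ n]
    with P hP
  refine hP.trans ?_
  simp [annTerm, extractOne, extractNone]

theorem wave_creOp {u : Momentum D → ℂ}
    (hk : IsBoundedKernel (shellMeasure D m) (Measure.dirac ()) (fun x _ => u x) C)
    (ψ : FiniteParticle D m) (n : ℕ) :
    wave (creOp hk ψ : Fock D m) n =ᵐ[shellPi D m n] creTerm u (ψ : Fock D m) n := by
  cases n with
  | zero => exact wave_wickEnd_of_lt _ _ hk ψ zero_lt_one
  | succ n =>
    filter_upwards [wave_wickEnd_add (r := 1) (s := 0) (extractNone D m) (extractOne D m) hk ψ n]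
      with P hP
    refine hP.trans ?_
    simp [creTerm, extractOne, extractNone]

theorem sqrt_natCast_succ_le (n : ℕ) : √((n : ℝ) + 1) ≤ n + 1 :=
  Real.sqrt_le_iff.mpr ⟨by positivity, by nlinarith [n.cast_nonneg (α := ℝ)]⟩

theorem stepBound_annOp {u : Momentum D → ℂ}
    (hk : IsBoundedKernel (Measure.dirac ()) (shellMeasure D m) (fun _ => u) C) :
    StepBound (annOp hk) C := by
  rw [← one_mul (C : ℝ)]
  refine stepBound_wickEnd (r := 0) (s := 1) _ _ hk zero_le_two zero_le_one fun n => ?_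
  rw [Fintype.card_fin, Fintype.card_unit, Nat.cast_one, Real.sqrt_one, mul_one, mul_one]
  push_cast
  linarith [sqrt_natCast_succ_le n]

theorem stepBound_creOp {u : Momentum D → ℂ}
    (hk : IsBoundedKernel (shellMeasure D m) (Measure.dirac ()) (fun x _ => u x) C) :
    StepBound (creOp hk) C := by
  rw [← one_mul (C : ℝ)]
  refine stepBound_wickEnd (r := 1) (s := 0) _ _ hk one_le_two zero_le_one fun n => ?_
  rw [Fintype.card_fin, Fintype.card_unit, Nat.cast_one, Real.sqrt_one, one_mul, mul_one,
    Nat.cast_zero, add_zero, Nat.cast_succ]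
  exact sqrt_natCast_succ_le n

/-- The amplitude of `a(p) a(q)` in the Wick square. -/
def annAnnKernel (m : ℝ) (h : SchwartzMap (Spacetime D) ℂ) (z : Momentum D × Momentum D) : ℂ :=
  fourierM h (-energy D m z.1 - energy D m z.2) (-z.1 - z.2)

/-- The amplitude of `a†(p) a(q)` in the Wick square. -/
def creAnnKernel (m : ℝ) (h : SchwartzMap (Spacetime D) ℂ) (p q : Momentum D) : ℂ :=
  fourierM h (energy D m p - energy D m q) (p - q)

/-- The amplitude of `a†(p) a†(q)` in the Wick square. -/
def creCreKernel (m : ℝ) (h : SchwartzMap (Spacetime D) ℂ) (z : Momentum D × Momentum D) : ℂ :=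
  fourierM h (energy D m z.1 + energy D m z.2) (z.1 + z.2)

variable {h : SchwartzMap (Spacetime D) ℂ}
  (haa : IsBoundedKernel (Measure.dirac ()) ((shellMeasure D m).prod (shellMeasure D m))
    (fun _ => annAnnKernel m h) C)
  (hca : IsBoundedKernel (shellMeasure D m) (shellMeasure D m) (creAnnKernel m h) C)
  (hcc : IsBoundedKernel ((shellMeasure D m).prod (shellMeasure D m)) (Measure.dirac ())
    (fun z _ => creCreKernel m h z) C)

/-- The pair annihilation part of the Wick square. -/
def annAnnOp : Module.End ℂ (FiniteParticle D m) :=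
  wickEnd (r := 0) (s := 2) (extractTwo D m) (extractNone D m) haa

/-- The number preserving part of the Wick square. -/
def creAnnOp : Module.End ℂ (FiniteParticle D m) :=
  wickEnd (r := 1) (s := 1) (extractOne D m) (extractOne D m) hca

/-- The pair creation part of the Wick square. -/
def creCreOp : Module.End ℂ (FiniteParticle D m) :=
  wickEnd (r := 2) (s := 0) (extractNone D m) (extractTwo D m) hcc

theorem natCast_card_pairs (n : ℕ) :
    (Fintype.card (Fin (n + 2) × Fin (n + 1)) : ℝ) = (n + 1) * (n + 2) := by
  simp only [Fintype.card_prod, Fintype.card_fin]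
  push_cast
  ring

theorem sqrt_card_pairs_le (n : ℕ) :
    √(Fintype.card (Fin (n + 2) × Fin (n + 1))) ≤ (n + 1) * 2 := by
  rw [natCast_card_pairs]
  exact Real.sqrt_le_iff.mpr ⟨by positivity, by nlinarith [n.cast_nonneg (α := ℝ)]⟩

theorem wave_annAnnOp (ψ : FiniteParticle D m) (n : ℕ) :
    wave (annAnnOp haa ψ : Fock D m) n =ᵐ[shellPi D m n] annAnnTerm h (ψ : Fock D m) n := by
  filter_upwards [wave_wickEnd_add (r := 0) (s := 2) (extractTwo D m) (extractNone D m) haa ψ n,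
    (extractTwo D m n).ae_integrable_kernel_mul (extractNone D m n) haa ((ψ : Fock D m) (n + 2)) ()]
    with P hP hint
  refine hP.trans ?_
  rw [Fintype.sum_unique, natCast_card_pairs, Fintype.card_unit, Nat.cast_one, Real.sqrt_one,
    div_one]
  exact congrArg _ (integral_prod _ hint)

theorem wave_creCreOp (ψ : FiniteParticle D m) (n : ℕ) :
    wave (creCreOp hcc ψ : Fock D m) n =ᵐ[shellPi D m n] creCreTerm h (ψ : Fock D m) n := by
  match n with
  | 0 => exact wave_wickEnd_of_lt _ _ hcc ψ zero_lt_two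
  | 1 => exact wave_wickEnd_of_lt _ _ hcc ψ one_lt_two
  | n + 2 =>
    filter_upwards [wave_wickEnd_add (r := 2) (s := 0) (extractNone D m) (extractTwo D m) hcc ψ n]
      with P hP
    refine hP.trans ?_
    rw [natCast_card_pairs, Fintype.card_unit, Nat.cast_one, Real.sqrt_one, one_div,
      Complex.ofReal_inv, Fintype.sum_prod_type]
    simp only [integral_dirac]
    rfl

theorem ae_update_eq_cons {n : ℕ} (g : NParticle D m (n + 1)) (i : Fin (n + 1)) :
    ∀ᵐ P ∂(shellPi D m (n + 1)), ∀ᵐ q ∂(shellMeasure D m),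
      (g : Lp ℂ 2 (shellPi D m (n + 1))) (Function.update P i q) =
        (g : Lp ℂ 2 (shellPi D m (n + 1))) (Matrix.vecCons q fun l => P (i.succAbove l)) := by
  obtain ⟨σ, hσ⟩ := (extractOne D m n).insert_proj i
  have hmp := measurePreserving_piFinSuccAbove (fun _ : Fin (n + 1) => shellMeasure D m) i
  have hperm := coeFn_pull (measurePreserving_perm D m (n + 1) σ)
    (g : Lp ℂ 2 (shellPi D m (n + 1)))
  rw [mem_NParticle_iff.mp g.2 σ] at hperm
  have hinsert := hmp.quasiMeasurePreserving.ae
    ((Measure.quasiMeasurePreserving_snd (μ := shellMeasure D m) (ν := shellPi D m n)).ae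
      (ae_ae_swap (hmp.symm.quasiMeasurePreserving.ae hperm)))
  filter_upwards [hinsert] with P hP
  filter_upwards [hP] with q hq
  have hupdate : (MeasurableEquiv.piFinSuccAbove (fun _ : Fin (n + 1) => Momentum D) i).symm
      (q, (MeasurableEquiv.piFinSuccAbove (fun _ : Fin (n + 1) => Momentum D) i P).2) =
        Function.update P i q := by
    change Fin.insertNth (α := fun _ => Momentum D) i q (fun l => P (i.succAbove l)) = _
    exact Fin.insertNth_removeNth i q P
  have hproj : (extractOne D m n).proj i (Function.update P i q) =
      (q, fun l => P (i.succAbove l)) := by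
    simp [extractOne]
  rw [hupdate] at hq
  rw [hq, Function.comp_apply, ← hσ, hproj]
  rfl

theorem wave_creAnnOp (ψ : FiniteParticle D m) (n : ℕ) :
    wave (creAnnOp hca ψ : Fock D m) n =ᵐ[shellPi D m n] creAnnTerm h (ψ : Fock D m) n := by
  cases n with
  | zero =>
    filter_upwards [wave_wickEnd_of_lt (r := 1) (s := 1) (extractOne D m) (extractOne D m) hca ψ
      zero_lt_one] with P hP
    exact hP.trans (by simp [creAnnTerm])
  | succ n =>
    filter_upwards [
      wave_wickEnd_add (r := 1) (s := 1) (extractOne D m) (extractOne D m) hca ψ n,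
      ae_all_iff.mpr (ae_update_eq_cons ((ψ : Fock D m) (n + 1)))] with P hP hupdate
    refine hP.trans ?_
    rw [div_self (by rw [Fintype.card_fin]; positivity), Complex.ofReal_one, one_mul]
    refine Finset.sum_congr rfl fun i _ => integral_congr_ae ?_
    filter_upwards [hupdate i] with q hq
    exact congrArg _ hq.symm

theorem stepBound_annAnnOp : StepBound (annAnnOp haa) (2 * C) :=
  stepBound_wickEnd (r := 0) (s := 2) _ _ haa zero_le_two zero_le_two fun n => by
    rw [Fintype.card_unit, Nat.cast_one, Real.sqrt_one, mul_one]
    refine (sqrt_card_pairs_le n).trans ?_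
    gcongr
    linarith

theorem stepBound_creAnnOp : StepBound (creAnnOp hca) C := by
  rw [← one_mul (C : ℝ)]
  refine stepBound_wickEnd (r := 1) (s := 1) _ _ hca one_le_two zero_le_one fun n => ?_
  rw [Fintype.card_fin, Real.mul_self_sqrt (Nat.cast_nonneg _)]
  push_cast
  linarith

theorem stepBound_creCreOp : StepBound (creCreOp hcc) (2 * C) :=
  stepBound_wickEnd (r := 2) (s := 0) _ _ hcc le_rfl zero_le_two fun n => by
    rw [Fintype.card_unit, Nat.cast_one, Real.sqrt_one, one_mul, Nat.cast_zero, add_zero]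
    exact sqrt_card_pairs_le n

end WickMonomials

/-! ### Decay of the Fourier transform -/

section Fourier

variable {D : ℕ}

/-- The point at which the standard Fourier transform equals `fourierM h k0 k`. -/
def fourierPoint (k0 : ℝ) (k : Momentum D) : Spacetime D :=
  WithLp.toLp 2 (Fin.cons (-((2 * Real.pi)⁻¹ * k0)) fun i => (2 * Real.pi)⁻¹ * k i)

theorem fourierM_eq_fourier (h : SchwartzMap (Spacetime D) ℂ) (k0 : ℝ) (k : Momentum D) :
    fourierM h k0 k = 𝓕 h (fourierPoint k0 k) := by
  rw [SchwartzMap.fourier_coe, Real.fourier_eq', fourierM]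
  refine integral_congr_ae (Filter.Eventually.of_forall fun x => ?_)
  have hinner : -2 * Real.pi * ⟪x, fourierPoint k0 k⟫_ℝ
      = -(-(k0 * x 0) + ∑ i : Fin D, k i * x i.succ) := by
    rw [PiLp.inner_apply, Fin.sum_univ_succ]
    simp only [fourierPoint, Fin.cons_zero, Fin.cons_succ, RCLike.inner_apply, conj_trivial]
    rw [mul_add, Finset.mul_sum, neg_add, ← Finset.sum_neg_distrib]
    congr 1
    · field_simp
    · refine Finset.sum_congr rfl fun i _ => ?_
      field_simp
  simp only [hinner, smul_eq_mul]
  rw [mul_comm]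
  congr 2
  push_cast
  ring

theorem continuous_fourierPoint :
    Continuous fun z : ℝ × Momentum D => fourierPoint z.1 z.2 := by
  refine (PiLp.continuous_toLp 2 _).comp (continuous_pi fun i => ?_)
  refine Fin.cases ?_ (fun j => ?_) i
  · simp only [Fin.cons_zero]; fun_prop
  · simp only [Fin.cons_succ]; fun_prop

theorem continuous_fourierM (h : SchwartzMap (Spacetime D) ℂ) :
    Continuous fun z : ℝ × Momentum D => fourierM h z.1 z.2 := by
  simp_rw [fourierM_eq_fourier]
  exact (𝓕 h).continuous.comp continuous_fourierPoint

theorem norm_sq_fourierPoint (k0 : ℝ) (k : Momentum D) :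
    ‖fourierPoint k0 k‖ ^ 2 = ((2 * Real.pi)⁻¹) ^ 2 * (k0 ^ 2 + ‖k‖ ^ 2) := by
  rw [EuclideanSpace.norm_sq_eq, EuclideanSpace.norm_sq_eq, Fin.sum_univ_succ]
  simp only [fourierPoint, Fin.cons_zero, Fin.cons_succ, Real.norm_eq_abs, sq_abs]
  rw [mul_add, Finset.mul_sum]
  congr 1
  · ring
  · exact Finset.sum_congr rfl fun i _ => by ring

theorem le_two_pi_mul_one_add_norm_fourierPoint (k0 : ℝ) (k : Momentum D) {a : ℝ} (ha : 0 ≤ a)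
    (h : a ^ 2 ≤ k0 ^ 2 + ‖k‖ ^ 2) : 1 + a ≤ 2 * Real.pi * (1 + ‖fourierPoint k0 k‖) := by
  have hπ := Real.pi_gt_three
  have h2π : a ≤ 2 * Real.pi * ‖fourierPoint k0 k‖ := by
    refine (sq_le_sq₀ ha (by positivity)).mp (h.trans_eq ?_)
    rw [mul_pow, norm_sq_fourierPoint]
    field_simp
  linarith

theorem fourierM_decay (h : SchwartzMap (Spacetime D) ℂ) (N : ℕ) :
    ∃ C : ℝ, 0 ≤ C ∧ ∀ (k0 : ℝ) (k : Momentum D) (a : ℝ), 0 ≤ a → a ^ 2 ≤ k0 ^ 2 + ‖k‖ ^ 2 →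
      (1 + a) ^ N * ‖fourierM h k0 k‖ ≤ C := by
  have hseminorm (x : Spacetime D) := SchwartzMap.one_add_le_sup_seminorm_apply (𝕜 := ℂ)
    (m := (N, 0)) (k := N) (n := 0) le_rfl le_rfl (𝓕 h) x
  set B := 2 ^ N * ((Finset.Iic (N, 0)).sup
    (fun m : ℕ × ℕ => SchwartzMap.seminorm ℂ (E := Spacetime D) (F := ℂ) m.1 m.2)) (𝓕 h)
  refine ⟨(2 * Real.pi) ^ N * B, by positivity, fun k0 k a ha hak => ?_⟩
  have hdecay := hseminorm (fourierPoint k0 k)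
  rw [norm_iteratedFDeriv_zero] at hdecay
  rw [fourierM_eq_fourier]
  calc (1 + a) ^ N * ‖𝓕 h (fourierPoint k0 k)‖
      ≤ (2 * Real.pi * (1 + ‖fourierPoint k0 k‖)) ^ N * ‖𝓕 h (fourierPoint k0 k)‖ := by
        gcongr
        exact le_two_pi_mul_one_add_norm_fourierPoint k0 k ha hak
    _ = (2 * Real.pi) ^ N * ((1 + ‖fourierPoint k0 k‖) ^ N * ‖𝓕 h (fourierPoint k0 k)‖) := by
        rw [mul_pow]; ring
    _ ≤ _ := by gcongr

theorem fourierM_smul (β : ℂ) (h : SchwartzMap (Spacetime D) ℂ) (k0 : ℝ) (k : Momentum D) :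
    fourierM (β • h) k0 k = β * fourierM h k0 k := by
  rw [fourierM, fourierM, ← integral_const_mul]
  simp only [smul_apply, smul_eq_mul, mul_assoc]

theorem conj_fourierM {h : SchwartzMap (Spacetime D) ℂ} (hh : ∀ x, (h x).im = 0) (k0 : ℝ)
    (k : Momentum D) : conj (fourierM h k0 k) = fourierM h (-k0) (-k) := by
  rw [fourierM, fourierM, ← integral_conj]
  refine integral_congr_ae (Filter.Eventually.of_forall fun x => ?_)
  simp only [map_mul, Complex.conj_eq_iff_im.mpr (hh x), ← Complex.exp_conj, map_neg,
    Complex.conj_I, Complex.conj_ofReal, neg_neg]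
  congr 2
  simp only [PiLp.neg_apply, neg_mul, Finset.sum_neg_distrib]
  push_cast
  ring

end Fourier

/-! ### The mass shell -/

section MassShell

variable {D : ℕ} {m : ℝ}

theorem continuous_energy (D : ℕ) (m : ℝ) : Continuous (energy D m) := by
  unfold energy
  fun_prop

theorem le_energy (p : Momentum D) : m ≤ energy D m p :=
  Real.le_sqrt_of_sq_le (le_add_of_nonneg_right (sq_nonneg _))

theorem energy_pos (hm : 0 < m) (p : Momentum D) : 0 < energy D m p := hm.trans_le (le_energy p)

theorem norm_le_energy (p : Momentum D) : ‖p‖ ≤ energy D m p :=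
  Real.le_sqrt_of_sq_le (le_add_of_nonneg_left (sq_nonneg _))

theorem energy_neg (p : Momentum D) : energy D m (-p) = energy D m p := by
  simp [energy]

theorem energy_le (hm : 0 < m) (p : Momentum D) : energy D m p ≤ (m + 1) * (1 + ‖p‖) := by
  refine Real.sqrt_le_iff.mpr ⟨by positivity, ?_⟩
  calc m ^ 2 + ‖p‖ ^ 2 ≤ (m + ‖p‖) ^ 2 := by nlinarith [norm_nonneg p]
    _ ≤ ((m + 1) * (1 + ‖p‖)) ^ 2 := by gcongr; nlinarith [norm_nonneg p]

/-- The density of the measure on the mass shell at zero momentum, where it is largest. -/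
def shellBound (D : ℕ) (m : ℝ) : ℝ := 1 / (2 * m * (2 * Real.pi) ^ D)

theorem measurable_shellDensity (D : ℕ) (m : ℝ) : Measurable fun p : Momentum D =>
    ENNReal.ofReal (1 / (2 * energy D m p * (2 * Real.pi) ^ D)) := by
  have := (continuous_energy D m).measurable
  fun_prop

theorem shellMeasure_le (hm : 0 < m) :
    shellMeasure D m ≤ ENNReal.ofReal (shellBound D m) • (volume : Measure (Momentum D)) := by
  rw [shellMeasure, ← withDensity_const]
  refine withDensity_mono (Filter.Eventually.of_forall fun p => ENNReal.ofReal_le_ofReal ?_)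
  have := le_energy (m := m) p
  have := Real.pi_pos
  rw [shellBound]
  gcongr

theorem lintegral_neg_shellMeasure {g : Momentum D → ℝ≥0∞} (hg : Measurable g) :
    ∫⁻ p, g (-p) ∂(shellMeasure D m) = ∫⁻ p, g p ∂(shellMeasure D m) := by
  rw [shellMeasure, lintegral_withDensity_eq_lintegral_mul _ (measurable_shellDensity D m) hg,
    lintegral_withDensity_eq_lintegral_mul _ (measurable_shellDensity D m)
      (show Measurable fun p => g (-p) from hg.comp measurable_neg), ← lintegral_neg_eq_self]
  simp [energy_neg]

theorem integrable_shellMeasure_one_add_norm (hm : 0 < m) :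
    Integrable (fun p : Momentum D => ((1 + ‖p‖) ^ (D + 1))⁻¹) (shellMeasure D m) := by
  have hrpow := integrable_one_add_norm (E := Momentum D) (μ := volume) (r := D + 1) (by simp)
  have hvolume : Integrable (fun p : Momentum D => ((1 + ‖p‖) ^ (D + 1))⁻¹) volume := by
    refine hrpow.congr (Filter.Eventually.of_forall fun p => ?_)
    change (1 + ‖p‖) ^ (-(D + 1 : ℝ)) = _
    rw [Real.rpow_neg (by positivity)]
    exact_mod_cast rfl
  exact (hvolume.smul_measure ENNReal.ofReal_ne_top).mono_measure (shellMeasure_le hm)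

theorem volume_real_unitBall_le (D : ℕ) :
    (volume : Measure (Momentum D)).real (Metric.ball 0 1) ≤ 2 ^ D := by
  have hsub : Metric.ball (0 : Momentum D) 1 ⊆
      WithLp.ofLp (p := 2) ⁻¹' (Set.univ.pi fun _ : Fin D => Set.Ioo (-1 : ℝ) 1) :=
    fun x hx i _ => abs_lt.mp ((PiLp.norm_apply_le x i).trans_lt (mem_ball_zero_iff.mp hx))
  have hcube : (volume : Measure (Momentum D)) (WithLp.ofLp (p := 2) ⁻¹'
      (Set.univ.pi fun _ : Fin D => Set.Ioo (-1 : ℝ) 1)) = 2 ^ D := by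
    rw [(PiLp.volume_preserving_ofLp (Fin D)).measure_preimage
      (MeasurableSet.univ_pi fun _ => measurableSet_Ioo).nullMeasurableSet, volume_pi_pi]
    simp only [Real.volume_Ioo]
    norm_num
  simpa [Measure.real] using ENNReal.toReal_mono (by simp) ((measure_mono hsub).trans_eq hcube)

theorem inv_sq_add_sq_eq (hm : 0 < m) (r : ℝ) :
    (m ^ 2 + r ^ 2)⁻¹ = (m ^ 2)⁻¹ * (1 + (m⁻¹ * r) ^ 2)⁻¹ := by
  rw [← mul_inv]
  congr 1
  field_simp

theorem integrableOn_Ioi_inv_sq_add_sq (hm : 0 < m) :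
    IntegrableOn (fun r : ℝ => (m ^ 2 + r ^ 2)⁻¹) (Set.Ioi 0) := by
  simp_rw [inv_sq_add_sq_eq hm]
  refine Integrable.const_mul ?_ _
  refine (integrableOn_Ioi_comp_mul_left_iff (fun x => (1 + x ^ 2)⁻¹) 0 (inv_pos.mpr hm)).mpr ?_
  exact integrable_inv_one_add_sq.integrableOn

theorem integral_Ioi_inv_sq_add_sq (hm : 0 < m) :
    ∫ r in Set.Ioi (0 : ℝ), (m ^ 2 + r ^ 2)⁻¹ = Real.pi / (2 * m) := by
  simp_rw [inv_sq_add_sq_eq hm]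
  rw [integral_const_mul, integral_comp_mul_left_Ioi (fun x => (1 + x ^ 2)⁻¹) 0 (inv_pos.mpr hm)]
  simp only [mul_zero, integral_Ioi_inv_one_add_sq, Real.arctan_zero, sub_zero, inv_inv,
    smul_eq_mul]
  field_simp

theorem pow_mul_inv_sqrt_pow_le (hD : 1 ≤ D) {r : ℝ} (hr : 0 < r) :
    r ^ (D - 1) * (√(m ^ 2 + r ^ 2) ^ (D + 1))⁻¹ ≤ (m ^ 2 + r ^ 2)⁻¹ := by
  have hsqrt : 0 < √(m ^ 2 + r ^ 2) := Real.sqrt_pos.mpr (by positivity)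
  have hle : r ≤ √(m ^ 2 + r ^ 2) := Real.le_sqrt_of_sq_le (by nlinarith)
  calc r ^ (D - 1) * (√(m ^ 2 + r ^ 2) ^ (D + 1))⁻¹
      ≤ √(m ^ 2 + r ^ 2) ^ (D - 1) * (√(m ^ 2 + r ^ 2) ^ (D + 1))⁻¹ := by gcongr
    _ = (√(m ^ 2 + r ^ 2) ^ 2)⁻¹ := by
        rw [show D + 1 = D - 1 + 2 by omega, pow_add, mul_inv,
          mul_inv_cancel_left₀ (pow_ne_zero _ hsqrt.ne')]
    _ = (m ^ 2 + r ^ 2)⁻¹ := by rw [Real.sq_sqrt (by positivity)]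

theorem integrableOn_pow_mul_inv_sqrt_pow (hD : 1 ≤ D) (hm : 0 < m) :
    IntegrableOn (fun r : ℝ => r ^ (D - 1) * (√(m ^ 2 + r ^ 2) ^ (D + 1))⁻¹) (Set.Ioi 0) := by
  refine Integrable.mono' (integrableOn_Ioi_inv_sq_add_sq hm) (by fun_prop) ?_
  filter_upwards [ae_restrict_mem measurableSet_Ioi] with r (hr : 0 < r)
  rw [Real.norm_of_nonneg (by positivity)]
  exact pow_mul_inv_sqrt_pow_le hD hr

theorem nontrivial_momentum (hD : 1 ≤ D) : Nontrivial (Momentum D) := by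
  have : Nonempty (Fin D) := ⟨⟨0, hD⟩⟩
  infer_instance

theorem integrable_inv_energy_pow (hD : 1 ≤ D) (hm : 0 < m) :
    Integrable fun p : Momentum D => (energy D m p ^ (D + 1))⁻¹ := by
  have := nontrivial_momentum hD
  refine (integrable_fun_norm_addHaar volume
    (f := fun r : ℝ => (√(m ^ 2 + r ^ 2) ^ (D + 1))⁻¹)).mpr ?_
  rw [finrank_euclideanSpace_fin]
  exact integrableOn_pow_mul_inv_sqrt_pow hD hm

theorem integral_inv_energy_pow_le (hD : 1 ≤ D) (hm : 0 < m) :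
    ∫ p : Momentum D, (energy D m p ^ (D + 1))⁻¹ ≤ D * 2 ^ D * (Real.pi / (2 * m)) := by
  have := nontrivial_momentum hD
  have hradial : ∫ r in Set.Ioi (0 : ℝ), r ^ (D - 1) * (√(m ^ 2 + r ^ 2) ^ (D + 1))⁻¹ ≤
      Real.pi / (2 * m) := by
    rw [← integral_Ioi_inv_sq_add_sq hm]
    exact setIntegral_mono_on (integrableOn_pow_mul_inv_sqrt_pow hD hm)
      (integrableOn_Ioi_inv_sq_add_sq hm) measurableSet_Ioi
      fun r hr => pow_mul_inv_sqrt_pow_le hD hr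
  calc ∫ p : Momentum D, (energy D m p ^ (D + 1))⁻¹
      = D * (volume : Measure (Momentum D)).real (Metric.ball 0 1) *
          ∫ r in Set.Ioi (0 : ℝ), r ^ (D - 1) * (√(m ^ 2 + r ^ 2) ^ (D + 1))⁻¹ := by
        have hpolar := integral_fun_norm_addHaar (volume : Measure (Momentum D))
          fun r : ℝ => (√(m ^ 2 + r ^ 2) ^ (D + 1))⁻¹
        rw [finrank_euclideanSpace_fin, nsmul_eq_mul, smul_eq_mul, ← mul_assoc] at hpolar
        exact hpolar
    _ ≤ D * 2 ^ D * (Real.pi / (2 * m)) := by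
        have := Real.pi_pos
        have := volume_real_unitBall_le D
        have : 0 ≤ ∫ r in Set.Ioi (0 : ℝ), r ^ (D - 1) * (√(m ^ 2 + r ^ 2) ^ (D + 1))⁻¹ :=
          setIntegral_nonneg measurableSet_Ioi fun r (hr : 0 < r) => by positivity
        gcongr

theorem natCast_mul_pi_le (D : ℕ) : D * Real.pi ≤ 4 * Real.pi ^ D := by
  obtain _ | n := D
  · norm_num
  have hn : ((n + 1 : ℕ) : ℝ) ≤ 2 ^ n := by exact_mod_cast Nat.lt_two_pow_self
  calc ((n + 1 : ℕ) : ℝ) * Real.pi ≤ Real.pi ^ n * Real.pi := by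
        gcongr
        exact hn.trans (pow_le_pow_left₀ zero_le_two Real.two_le_pi n)
    _ ≤ 4 * Real.pi ^ (n + 1) := by
        rw [← pow_succ]
        linarith [pow_pos Real.pi_pos (n + 1)]

theorem shellBound_nonneg (hm : 0 < m) : 0 ≤ shellBound D m := by
  have := Real.pi_pos
  rw [shellBound]
  positivity

theorem shellBound_mul_lintegral_energy_le (hD : 1 ≤ D) (hm : 0 < m) {c : ℝ} (hc : 0 ≤ c) :
    ENNReal.ofReal (shellBound D m) *
      ∫⁻ p : Momentum D, ENNReal.ofReal (c * m ^ 2 * (energy D m p ^ (D + 1))⁻¹) ≤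
        ENNReal.ofReal c := by
  have := shellBound_nonneg (D := D) hm
  have := Real.pi_pos
  rw [← ofReal_integral_eq_lintegral_ofReal ((integrable_inv_energy_pow hD hm).const_mul _)
    (Filter.Eventually.of_forall fun p => by have := energy_pos hm p; positivity),
    ← ENNReal.ofReal_mul (shellBound_nonneg hm), integral_const_mul]
  refine ENNReal.ofReal_le_ofReal ?_
  calc shellBound D m * (c * m ^ 2 * ∫ p : Momentum D, (energy D m p ^ (D + 1))⁻¹)
      ≤ shellBound D m * (c * m ^ 2 * (D * 2 ^ D * (Real.pi / (2 * m)))) := by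
        gcongr
        exact integral_inv_energy_pow_le hD hm
    _ = c * ((D * Real.pi) / (4 * Real.pi ^ D)) := by
        rw [shellBound, mul_pow]
        field_simp
        ring
    _ ≤ c := mul_le_of_le_one_right hc (div_le_one_of_le₀ (natCast_mul_pi_le D) (by positivity))

end MassShell

/-! ### The kernels of the Wick square -/

section WickKernels

variable {D : ℕ} {m : ℝ}

theorem bddAbove_cConst (hm : 0 < m) (h : SchwartzMap (Spacetime D) ℂ) :
    BddAbove {y : ℝ | ∃ (p k : Momentum D) (s t : ℤˣ),
      y = energy D m p ^ (D + 1) / m ^ 2 *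
        ‖fourierM h (((s : ℤ) : ℝ) * energy D m (p + k) + ((t : ℤ) : ℝ) * energy D m k) p‖} := by
  obtain ⟨C, -, hC⟩ := fourierM_decay h (D + 1)
  refine ⟨(m + 1) ^ (D + 1) / m ^ 2 * C, ?_⟩
  rintro y ⟨p, k, s, t, rfl⟩
  have hdecay := hC (((s : ℤ) : ℝ) * energy D m (p + k) + ((t : ℤ) : ℝ) * energy D m k) p ‖p‖
    (norm_nonneg p) (le_add_of_nonneg_left (sq_nonneg _))
  have henergy : energy D m p ^ (D + 1) ≤ (m + 1) ^ (D + 1) * (1 + ‖p‖) ^ (D + 1) := by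
    rw [← mul_pow]
    exact pow_le_pow_left₀ (energy_pos hm p).le (energy_le hm p) _
  calc _ ≤ (m + 1) ^ (D + 1) * (1 + ‖p‖) ^ (D + 1) / m ^ 2 * ‖fourierM h
        (((s : ℤ) : ℝ) * energy D m (p + k) + ((t : ℤ) : ℝ) * energy D m k) p‖ := by gcongr
    _ = (m + 1) ^ (D + 1) / m ^ 2 * ((1 + ‖p‖) ^ (D + 1) * ‖fourierM h
        (((s : ℤ) : ℝ) * energy D m (p + k) + ((t : ℤ) : ℝ) * energy D m k) p‖) := by ring
    _ ≤ _ := by gcongr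

theorem cConst_nonneg (hm : 0 < m) (h : SchwartzMap (Spacetime D) ℂ) : 0 ≤ cConst m h := by
  refine Real.sSup_nonneg ?_
  rintro y ⟨p, k, s, t, rfl⟩
  have := energy_pos hm p
  positivity

theorem norm_creAnnKernel_le (hm : 0 < m) (h : SchwartzMap (Spacetime D) ℂ) (p q : Momentum D) :
    ‖creAnnKernel m h p q‖ ≤ cConst m h * m ^ 2 * (energy D m (p - q) ^ (D + 1))⁻¹ := by
  have hle := le_csSup (bddAbove_cConst hm h) ⟨p - q, q, 1, -1, rfl⟩
  simp only [Units.val_one, Units.val_neg, Int.cast_one, Int.cast_neg, one_mul, neg_mul,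
    sub_add_cancel, ← sub_eq_add_neg] at hle
  have := energy_pos hm (p - q)
  rw [← div_eq_mul_inv, le_div_iff₀ (by positivity)]
  rwa [div_mul_eq_mul_div, div_le_iff₀ (by positivity), mul_comm] at hle

theorem stronglyMeasurable_creAnnKernel (m : ℝ) (h : SchwartzMap (Spacetime D) ℂ) :
    StronglyMeasurable (Function.uncurry (creAnnKernel m h)) := by
  have := continuous_energy D m
  exact ((continuous_fourierM h).comp (by fun_prop : Continuous fun z : Momentum D × Momentum D =>
    (energy D m z.1 - energy D m z.2, z.1 - z.2))).stronglyMeasurable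

theorem lintegral_shellMeasure_le (hm : 0 < m) (g : Momentum D → ℝ≥0∞) :
    ∫⁻ p, g p ∂shellMeasure D m ≤ ENNReal.ofReal (shellBound D m) * ∫⁻ p, g p := by
  rw [← smul_eq_mul, ← lintegral_smul_measure]
  exact lintegral_mono' (shellMeasure_le hm) le_rfl

theorem isBoundedKernel_creAnnKernel (hD : 1 ≤ D) (hm : 0 < m) (h : SchwartzMap (Spacetime D) ℂ) :
    IsBoundedKernel (shellMeasure D m) (shellMeasure D m) (creAnnKernel m h)
      (cConst m h).toNNReal := by
  have hle (p q : Momentum D) : ‖creAnnKernel m h p q‖ₑ ≤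
      ENNReal.ofReal (cConst m h * m ^ 2 * (energy D m (p - q) ^ (D + 1))⁻¹) := by
    rw [← ofReal_norm]
    exact ENNReal.ofReal_le_ofReal (norm_creAnnKernel_le hm h p q)
  have hC := shellBound_mul_lintegral_energy_le hD hm (cConst_nonneg hm h)
  refine .of_schur (stronglyMeasurable_creAnnKernel m h) (fun p => ?_) (fun q => ?_)
  · refine (lintegral_mono (hle p)).trans ((lintegral_shellMeasure_le hm _).trans ?_)
    rwa [lintegral_sub_left_eq_self (fun x : Momentum D =>
      ENNReal.ofReal (cConst m h * m ^ 2 * (energy D m x ^ (D + 1))⁻¹)) p]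
  · refine (lintegral_mono fun p => hle p q).trans ((lintegral_shellMeasure_le hm _).trans ?_)
    rwa [lintegral_sub_right_eq_self (fun x : Momentum D =>
      ENNReal.ofReal (cConst m h * m ^ 2 * (energy D m x ^ (D + 1))⁻¹)) q]

/-- The kernel `(p, q) ↦ h̃(s (ω_p + ω_q), p + q)`, whose `L²` norm is `pairNorm m h s`. -/
def pairKernel (m : ℝ) (h : SchwartzMap (Spacetime D) ℂ) (s : ℤˣ) (z : Momentum D × Momentum D) :
    ℂ :=
  fourierM h (((s : ℤ) : ℝ) * (energy D m z.1 + energy D m z.2)) (z.1 + z.2)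

theorem continuous_pairKernel (m : ℝ) (h : SchwartzMap (Spacetime D) ℂ) (s : ℤˣ) :
    Continuous (pairKernel m h s) := by
  have := continuous_energy D m
  exact (continuous_fourierM h).comp (by fun_prop : Continuous fun z : Momentum D × Momentum D =>
    (((s : ℤ) : ℝ) * (energy D m z.1 + energy D m z.2), z.1 + z.2))

theorem exists_norm_pairKernel_le (m : ℝ) (h : SchwartzMap (Spacetime D) ℂ) (s : ℤˣ) :
    ∃ C : ℝ, ∀ z, (1 + (‖z.1‖ + ‖z.2‖)) ^ (D + 1) * ‖pairKernel m h s z‖ ≤ C := by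
  obtain ⟨C, -, hC⟩ := fourierM_decay h (D + 1)
  refine ⟨C, fun z => hC _ _ _ (by positivity) ?_⟩
  have hs : (((s : ℤ) : ℝ)) ^ 2 = 1 := by
    rcases Int.units_eq_one_or s with rfl | rfl <;> simp
  rw [mul_pow, hs, one_mul]
  exact le_add_of_le_of_nonneg
    (pow_le_pow_left₀ (by positivity) (add_le_add (norm_le_energy z.1) (norm_le_energy z.2)) 2)
    (sq_nonneg _)

theorem integrable_norm_sq_pairKernel (hm : 0 < m) (h : SchwartzMap (Spacetime D) ℂ) (s : ℤˣ) :
    Integrable (fun z => ‖pairKernel m h s z‖ ^ 2)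
      ((shellMeasure D m).prod (shellMeasure D m)) := by
  obtain ⟨C, hC⟩ := exists_norm_pairKernel_le m h s
  have hint := integrable_shellMeasure_one_add_norm (D := D) hm
  refine Integrable.mono' ((hint.mul_prod hint).const_mul (C ^ 2))
    (((continuous_pairKernel m h s).norm.pow 2).aestronglyMeasurable)
    (Filter.Eventually.of_forall fun z => ?_)
  have hprod : (1 + ‖z.1‖) * (1 + ‖z.2‖) ≤ (1 + (‖z.1‖ + ‖z.2‖)) ^ 2 := by
    nlinarith [norm_nonneg z.1, norm_nonneg z.2, mul_nonneg (norm_nonneg z.1) (norm_nonneg z.2)]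
  rw [Real.norm_of_nonneg (by positivity), ← mul_inv, ← mul_pow, ← div_eq_mul_inv,
    le_div_iff₀ (by positivity)]
  calc ‖pairKernel m h s z‖ ^ 2 * ((1 + ‖z.1‖) * (1 + ‖z.2‖)) ^ (D + 1)
      ≤ ‖pairKernel m h s z‖ ^ 2 * ((1 + (‖z.1‖ + ‖z.2‖)) ^ 2) ^ (D + 1) := by gcongr
    _ = ((1 + (‖z.1‖ + ‖z.2‖)) ^ (D + 1) * ‖pairKernel m h s z‖) ^ 2 := by
        rw [pow_right_comm, mul_pow, mul_comm]
    _ ≤ C ^ 2 := pow_le_pow_left₀ (by positivity) (hC z) 2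

theorem pairNorm_nonneg (m : ℝ) (h : SchwartzMap (Spacetime D) ℂ) (s : ℤˣ) : 0 ≤ pairNorm m h s :=
  Real.sqrt_nonneg _

theorem lintegral_enorm_sq_pairKernel (hm : 0 < m) (h : SchwartzMap (Spacetime D) ℂ) (s : ℤˣ) :
    ∫⁻ z, ‖pairKernel m h s z‖ₑ ^ 2 ∂((shellMeasure D m).prod (shellMeasure D m)) =
      ((pairNorm m h s).toNNReal : ℝ≥0∞) ^ 2 := by
  have hint := integrable_norm_sq_pairKernel hm h s
  have hsq : pairNorm m h s ^ 2 =
      ∫ z, ‖pairKernel m h s z‖ ^ 2 ∂((shellMeasure D m).prod (shellMeasure D m)) := by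
    rw [pairNorm, Real.sq_sqrt (integral_nonneg fun p => integral_nonneg fun q => sq_nonneg _),
      integral_prod _ hint]
    rfl
  rw [← ENNReal.ofReal, ← ENNReal.ofReal_pow (pairNorm_nonneg m h s), hsq,
    ofReal_integral_eq_lintegral_ofReal hint (Filter.Eventually.of_forall fun z => sq_nonneg _)]
  refine lintegral_congr fun z => ?_
  rw [ENNReal.ofReal_pow (norm_nonneg _), ofReal_norm]

theorem creCreKernel_eq_pairKernel (m : ℝ) (h : SchwartzMap (Spacetime D) ℂ) :
    creCreKernel m h = pairKernel m h 1 := by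
  funext z
  simp [creCreKernel, pairKernel]

theorem annAnnKernel_eq_pairKernel (m : ℝ) (h : SchwartzMap (Spacetime D) ℂ) :
    annAnnKernel m h = fun z => pairKernel m h (-1) (-z.1, -z.2) := by
  funext z
  simp only [annAnnKernel, pairKernel, energy_neg, Units.val_neg, Units.val_one, Int.cast_neg,
    Int.cast_one]
  congr 1
  ring

theorem isBoundedKernel_creCreKernel (hm : 0 < m) (h : SchwartzMap (Spacetime D) ℂ) :
    IsBoundedKernel ((shellMeasure D m).prod (shellMeasure D m)) (Measure.dirac ())
      (fun z (_ : Unit) => creCreKernel m h z) (pairNorm m h 1).toNNReal := by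
  rw [creCreKernel_eq_pairKernel]
  exact isBoundedKernel_column (continuous_pairKernel m h 1).stronglyMeasurable
    (lintegral_enorm_sq_pairKernel hm h 1).le

theorem isBoundedKernel_annAnnKernel (hm : 0 < m) (h : SchwartzMap (Spacetime D) ℂ) :
    IsBoundedKernel (Measure.dirac ()) ((shellMeasure D m).prod (shellMeasure D m))
      (fun _ : Unit => annAnnKernel m h) (pairNorm m h (-1)).toNNReal := by
  have hcont := continuous_pairKernel m h (-1)
  have hcont_neg : Continuous fun z : Momentum D × Momentum D =>
      pairKernel m h (-1) (-z.1, -z.2) := hcont.comp (by fun_prop)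
  rw [annAnnKernel_eq_pairKernel]
  refine isBoundedKernel_row hcont_neg.stronglyMeasurable (le_of_eq ?_)
  rw [← lintegral_enorm_sq_pairKernel hm h (-1), lintegral_prod _ (by fun_prop),
    lintegral_prod _ (by fun_prop)]
  have hinner (p : Momentum D) :
      ∫⁻ q, ‖pairKernel m h (-1) (-p, -q)‖ₑ ^ 2 ∂(shellMeasure D m) =
        ∫⁻ q, ‖pairKernel m h (-1) (-p, q)‖ₑ ^ 2 ∂(shellMeasure D m) :=
    lintegral_neg_shellMeasure (g := fun q => ‖pairKernel m h (-1) (-p, q)‖ₑ ^ 2)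
      ((hcont.comp (by fun_prop : Continuous fun q => (-p, q))).measurable.enorm.pow_const 2)
  simp_rw [hinner]
  refine lintegral_neg_shellMeasure
    (g := fun p => ∫⁻ q, ‖pairKernel m h (-1) (p, q)‖ₑ ^ 2 ∂(shellMeasure D m)) ?_
  exact Measurable.lintegral_prod_right' (f := fun z => ‖pairKernel m h (-1) z‖ₑ ^ 2) (by fun_prop)

end WickKernels

/-! ### The field and the Wick square -/

section Operators

theorem isSymmetric_add_of_inner_eq {𝕜 E : Type*} [RCLike 𝕜] [SeminormedAddCommGroup E]
    [InnerProductSpace 𝕜 E] {A B : E →ₗ[𝕜] E} (h : ∀ x y, inner 𝕜 (A x) y = inner 𝕜 x (B y)) :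
    (A + B).IsSymmetric := fun x y => by
  have hBA : inner 𝕜 (B x) y = inner 𝕜 x (A y) := by
    rw [← inner_conj_symm, ← h, inner_conj_symm]
  rw [LinearMap.add_apply, LinearMap.add_apply, inner_add_left, inner_add_right, h, hBA, add_comm]

variable {D : ℕ} {m : ℝ}

theorem wave_add (ψ φ : Fock D m) (n : ℕ) :
    wave (ψ + φ) n =ᵐ[shellPi D m n] fun P => wave ψ n P + wave φ n P :=
  Lp.coeFn_add _ _

theorem wave_smul (c : ℂ) (ψ : Fock D m) (n : ℕ) :
    wave (c • ψ) n =ᵐ[shellPi D m n] fun P => c * wave ψ n P :=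
  Lp.coeFn_smul c _

theorem annTerm_congr {u v : Momentum D → ℂ} (h : u =ᵐ[shellMeasure D m] v) (ψ : Fock D m) (n : ℕ) :
    annTerm u ψ n = annTerm v ψ n := by
  funext P
  exact congrArg _ (integral_congr_ae (h.mul .rfl))

theorem creTerm_congr {u v : Momentum D → ℂ} (h : u =ᵐ[shellMeasure D m] v) (ψ : Fock D m) (n : ℕ) :
    creTerm u ψ n =ᵐ[shellPi D m n] creTerm v ψ n := by
  cases n with
  | zero => rfl
  | succ n =>
    have hP : ∀ᵐ P ∂shellPi D m (n + 1), ∀ i, u (P i) = v (P i) :=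
      ae_all_iff.mpr fun i =>
      (Measure.quasiMeasurePreserving_eval (fun _ => shellMeasure D m) i).ae h
    filter_upwards [hP] with P hP
    simp only [creTerm, hP]

theorem annTerm_const_mul (c : ℂ) (u : Momentum D → ℂ) (ψ : Fock D m) (n : ℕ)
    (P : Fin n → Momentum D) : annTerm (fun p => c * u p) ψ n P = c * annTerm u ψ n P := by
  simp only [annTerm, mul_assoc, integral_const_mul]
  ring

theorem creTerm_const_mul (c : ℂ) (u : Momentum D → ℂ) (ψ : Fock D m) (n : ℕ)
    (P : Fin n → Momentum D) : creTerm (fun p => c * u p) ψ n P = c * creTerm u ψ n P := by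
  cases n with
  | zero => simp [creTerm]
  | succ n =>
    simp only [creTerm, mul_assoc, ← Finset.mul_sum]
    ring

theorem isField_smul_annOp_add_creOp {f : Smearing D m} {u v : Momentum D → ℂ} {C C' : ℝ≥0}
    (hu : f.1 =ᵐ[shellMeasure D m] u) (hv : f.2 =ᵐ[shellMeasure D m] v)
    (hku : IsBoundedKernel (shellMeasure D m) (Measure.dirac ()) (fun x _ => u x) C)
    (hkv : IsBoundedKernel (Measure.dirac ()) (shellMeasure D m) (fun _ => v) C') :
    IsField f ((Real.sqrt 2 : ℂ)⁻¹ • (annOp hkv + creOp hku)) := fun ψ n => by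
  filter_upwards [
    wave_smul (Real.sqrt 2 : ℂ)⁻¹ ((annOp hkv ψ : Fock D m) + (creOp hku ψ : Fock D m)) n,
    wave_add (annOp hkv ψ : Fock D m) (creOp hku ψ) n, wave_annOp hkv ψ n, wave_creOp hku ψ n,
    creTerm_congr hu (ψ : Fock D m) n] with P hsmul hadd hann hcre hcongr
  refine hsmul.trans ?_
  rw [hadd, hann, hcre, annTerm_congr hv, hcongr]

theorem lintegral_enorm_sq_coeFn (u : OneParticle D m) :
    ∫⁻ x, ‖u x‖ₑ ^ 2 ∂(shellMeasure D m) = (‖u‖₊ : ℝ≥0∞) ^ 2 := by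
  rw [← eLpNorm_two_sq, ← enorm_eq_nnnorm, Lp.enorm_def]

theorem isBoundedKernel_row_coeFn (u : OneParticle D m) :
    IsBoundedKernel (Measure.dirac ()) (shellMeasure D m) (fun _ => u) ‖u‖₊ :=
  isBoundedKernel_row (Lp.stronglyMeasurable u) (lintegral_enorm_sq_coeFn u).le

theorem isBoundedKernel_column_coeFn (u : OneParticle D m) :
    IsBoundedKernel (shellMeasure D m) (Measure.dirac ()) (fun x _ => u x) ‖u‖₊ :=
  isBoundedKernel_column (Lp.stronglyMeasurable u) (lintegral_enorm_sq_coeFn u).le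

theorem isField_field (f : Smearing D m) : IsField f (field f) :=
  Classical.epsilon_spec (p := IsField f) ⟨_, isField_smul_annOp_add_creOp .rfl .rfl
    (isBoundedKernel_column_coeFn f.1) (isBoundedKernel_row_coeFn f.2)⟩

theorem field_eq_smul_annOp_add_creOp {f : Smearing D m} {u v : Momentum D → ℂ} {C C' : ℝ≥0}
    (hu : f.1 =ᵐ[shellMeasure D m] u) (hv : f.2 =ᵐ[shellMeasure D m] v)
    (hku : IsBoundedKernel (shellMeasure D m) (Measure.dirac ()) (fun x _ => u x) C)
    (hkv : IsBoundedKernel (Measure.dirac ()) (shellMeasure D m) (fun _ => v) C') :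
    field f = (Real.sqrt 2 : ℂ)⁻¹ • (annOp hkv + creOp hku) :=
  (isField_field f).unique (isField_smul_annOp_add_creOp hu hv hku hkv)

theorem stepBound_field (f : Smearing D m) : StepBound (field f) (‖f.1‖ + ‖f.2‖) := by
  have hku := isBoundedKernel_column_coeFn f.1
  have hkv := isBoundedKernel_row_coeFn f.2
  rw [field_eq_smul_annOp_add_creOp .rfl .rfl hku hkv]
  refine (((stepBound_annOp hkv).add (stepBound_creOp hku)).smul _).mono ?_
  rw [norm_inv, Complex.norm_of_nonneg (Real.sqrt_nonneg 2), coe_nnnorm, coe_nnnorm, add_comm]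
  exact mul_le_of_le_one_left (by positivity)
    (inv_le_one_of_one_le₀ (Real.one_le_sqrt.mpr one_le_two))

theorem field_smul (α : ℂ) (f : Smearing D m) : field (α • f) = α • field f := by
  refine (isField_field (α • f)).unique fun ψ n => ?_
  filter_upwards [wave_smul α (field f ψ : Fock D m) n, isField_field f ψ n,
    creTerm_congr (Lp.coeFn_smul α f.1) (ψ : Fock D m) n] with P hsmul hfield hcre
  refine hsmul.trans ?_
  rw [hfield, show (α • f).1 = α • f.1 from rfl, show (α • f).2 = α • f.2 from rfl, hcre,
    annTerm_congr (Lp.coeFn_smul α f.2)]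
  simp only [Pi.smul_def, smul_eq_mul, annTerm_const_mul, creTerm_const_mul]
  ring

theorem isSymmetric_field {f : Smearing D m} (hf : f.IsReal) :
    LinearMap.IsSymmetric (𝕜 := ℂ) (E := FiniteParticle D m) (field f) := by
  let v : Momentum D → ℂ := fun p => conj (f.1 p)
  have hku := isBoundedKernel_column_coeFn f.1
  have hkv : IsBoundedKernel (Measure.dirac ()) (shellMeasure D m) (fun _ => v) ‖f.1‖₊ :=
    isBoundedKernel_row
      (Complex.continuous_conj.comp_stronglyMeasurable (Lp.stronglyMeasurable f.1))
      (by simpa only [v, RCLike.enorm_conj] using (lintegral_enorm_sq_coeFn f.1).le)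
  rw [field_eq_smul_annOp_add_creOp .rfl hf hku hkv]
  have hadj : LinearMap.IsSymmetric (𝕜 := ℂ) (E := FiniteParticle D m) (annOp hkv + creOp hku) :=
    isSymmetric_add_of_inner_eq
      (inner_wickEnd_left _ _ hkv hku fun _ _ => (Complex.conj_conj _).symm)
  exact hadj.smul (by rw [map_inv₀, Complex.conj_ofReal])

theorem isWickSquare_smul_sum {h : SchwartzMap (Spacetime D) ℂ} {C C' C'' : ℝ≥0}
    (haa : IsBoundedKernel (Measure.dirac ()) ((shellMeasure D m).prod (shellMeasure D m))
      (fun _ => annAnnKernel m h) C)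
    (hca : IsBoundedKernel (shellMeasure D m) (shellMeasure D m) (creAnnKernel m h) C')
    (hcc : IsBoundedKernel ((shellMeasure D m).prod (shellMeasure D m)) (Measure.dirac ())
      (fun z _ => creCreKernel m h z) C'') :
    IsWickSquare h ((1 / 2 : ℂ) • (annAnnOp haa + (2 : ℂ) • creAnnOp hca + creCreOp hcc)) :=
  fun ψ n => by
  filter_upwards [wave_smul (1 / 2 : ℂ)
      ((annAnnOp haa ψ : Fock D m) + (2 : ℂ) • (creAnnOp hca ψ : Fock D m) +
        (creCreOp hcc ψ : Fock D m)) n,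
    wave_add ((annAnnOp haa ψ : Fock D m) + (2 : ℂ) • (creAnnOp hca ψ : Fock D m))
      (creCreOp hcc ψ) n,
    wave_add (annAnnOp haa ψ : Fock D m) ((2 : ℂ) • (creAnnOp hca ψ : Fock D m)) n,
    wave_smul (2 : ℂ) (creAnnOp hca ψ : Fock D m) n, wave_annAnnOp haa ψ n,
    wave_creAnnOp hca ψ n, wave_creCreOp hcc ψ n] with P hhalf hadd hadd' htwo hann hca' hcre
  refine hhalf.trans ?_
  rw [hadd, hadd', htwo, hann, hca', hcre]

theorem isWickSquare_wickSquare (hD : 1 ≤ D) (hm : 0 < m) (h : SchwartzMap (Spacetime D) ℂ) :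
    IsWickSquare h (wickSquare m h) :=
  Classical.epsilon_spec (p := IsWickSquare h) ⟨_, isWickSquare_smul_sum
    (isBoundedKernel_annAnnKernel hm h) (isBoundedKernel_creAnnKernel hD hm h)
    (isBoundedKernel_creCreKernel hm h)⟩

theorem wickSquare_eq_smul_sum (hD : 1 ≤ D) (hm : 0 < m) (h : SchwartzMap (Spacetime D) ℂ) :
    wickSquare m h = (1 / 2 : ℂ) • (annAnnOp (isBoundedKernel_annAnnKernel hm h) +
      (2 : ℂ) • creAnnOp (isBoundedKernel_creAnnKernel hD hm h) +
      creCreOp (isBoundedKernel_creCreKernel hm h)) :=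
  (isWickSquare_wickSquare hD hm h).unique (isWickSquare_smul_sum _ _ _)

theorem stepBound_wickSquare (hD : 1 ≤ D) (hm : 0 < m) (h : SchwartzMap (Spacetime D) ℂ) :
    StepBound (wickSquare m h) (pairNorm m h (-1) + cConst m h + pairNorm m h 1) := by
  rw [wickSquare_eq_smul_sum hD hm]
  refine ((((stepBound_annAnnOp _).add ((stepBound_creAnnOp _).smul 2)).add
    (stepBound_creCreOp _)).smul _).mono (le_of_eq ?_)
  rw [Real.coe_toNNReal _ (pairNorm_nonneg m h (-1)), Real.coe_toNNReal _ (cConst_nonneg hm h),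
    Real.coe_toNNReal _ (pairNorm_nonneg m h 1)]
  norm_num
  ring

theorem wickSquare_smul (hD : 1 ≤ D) (hm : 0 < m) (β : ℂ) (h : SchwartzMap (Spacetime D) ℂ) :
    wickSquare m (β • h) = β • wickSquare m h := by
  refine (isWickSquare_wickSquare hD hm (β • h)).unique fun ψ n => ?_
  filter_upwards [wave_smul β (wickSquare m h ψ : Fock D m) n,
    isWickSquare_wickSquare hD hm h ψ n] with P hsmul hwick
  have haa : annAnnTerm (β • h) (ψ : Fock D m) n P = β * annAnnTerm h (ψ : Fock D m) n P := by
    simp only [annAnnTerm, fourierM_smul, mul_assoc, integral_const_mul]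
    ring
  have hca : creAnnTerm (β • h) (ψ : Fock D m) n P = β * creAnnTerm h (ψ : Fock D m) n P := by
    simp only [creAnnTerm, fourierM_smul, mul_assoc, integral_const_mul, Finset.mul_sum]
  have hcc : creCreTerm (β • h) (ψ : Fock D m) n P = β * creCreTerm h (ψ : Fock D m) n P := by
    match n with
    | 0 => simp [creCreTerm]
    | 1 => simp [creCreTerm]
    | n + 2 =>
      simp only [creCreTerm, fourierM_smul, mul_assoc, ← Finset.mul_sum]
      ring
  refine hsmul.trans ?_
  rw [hwick, haa, hca, hcc]
  ring

theorem isSymmetric_wickSquare (hD : 1 ≤ D) (hm : 0 < m) {h : SchwartzMap (Spacetime D) ℂ}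
    (hh : ∀ x, (h x).im = 0) :
    LinearMap.IsSymmetric (𝕜 := ℂ) (E := FiniteParticle D m) (wickSquare m h) := by
  rw [wickSquare_eq_smul_sum hD hm]
  set A := annAnnOp (isBoundedKernel_annAnnKernel hm h)
  set B := creAnnOp (isBoundedKernel_creAnnKernel hD hm h)
  set C := creCreOp (isBoundedKernel_creCreKernel hm h)
  have hAC : LinearMap.IsSymmetric (𝕜 := ℂ) (E := FiniteParticle D m) (A + C) :=
    isSymmetric_add_of_inner_eq (inner_wickEnd_left _ _ _ _ fun z _ => by
      simp only [creCreKernel, annAnnKernel]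
      rw [conj_fourierM hh]
      congr 1
      · ring
      · abel)
  have hB : LinearMap.IsSymmetric (𝕜 := ℂ) (E := FiniteParticle D m) B :=
    inner_wickEnd_left _ _ _ _ fun p q => by
      simp only [creAnnKernel]
      rw [conj_fourierM hh, neg_sub, neg_sub]
  have hsum := hAC.add (hB.smul (map_ofNat (starRingEnd ℂ) 2))
  rw [add_right_comm] at hsum
  exact hsum.smul (by rw [map_div₀, map_one, map_ofNat])

end Operators

/-! ### The constant `K` -/

section Constants

variable {D : ℕ} {m : ℝ}

theorem le_KConst (f : Smearing D m) (h : SchwartzMap (Spacetime D) ℂ) :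
    ‖f.1‖ ≤ KConst f h ∧ ‖f.2‖ ≤ KConst f h ∧ cConst m h ≤ KConst f h ∧
      pairNorm m h 1 ≤ KConst f h ∧ pairNorm m h (-1) ≤ KConst f h := by
  simp [KConst]

theorem KConst_nonneg (f : Smearing D m) (h : SchwartzMap (Spacetime D) ℂ) : 0 ≤ KConst f h :=
  (norm_nonneg f.1).trans (le_KConst f h).1

theorem cConst_smul_le (hm : 0 < m) (h : SchwartzMap (Spacetime D) ℂ) {β : ℝ} (hβ : 0 ≤ β) :
    cConst m ((β : ℂ) • h) ≤ β * cConst m h := by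
  refine Real.sSup_le ?_ (mul_nonneg hβ (cConst_nonneg hm h))
  rintro y ⟨p, k, s, t, rfl⟩
  rw [fourierM_smul, norm_mul, Complex.norm_of_nonneg hβ, mul_left_comm]
  exact mul_le_mul_of_nonneg_left (le_csSup (bddAbove_cConst hm h) ⟨p, k, s, t, rfl⟩) hβ

theorem pairNorm_smul (m : ℝ) (h : SchwartzMap (Spacetime D) ℂ) {β : ℝ} (hβ : 0 ≤ β) (s : ℤˣ) :
    pairNorm m ((β : ℂ) • h) s = β * pairNorm m h s := by
  simp only [pairNorm, fourierM_smul, norm_mul, Complex.norm_of_nonneg hβ, mul_pow,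
    integral_const_mul]
  rw [Real.sqrt_mul (sq_nonneg β), Real.sqrt_sq hβ]

theorem KConst_smul_le (hm : 0 < m) (f : Smearing D m) (h : SchwartzMap (Spacetime D) ℂ) {α β : ℝ}
    (hα : 0 ≤ α) (hβ : 0 ≤ β) :
    KConst ((α : ℂ) • f) ((β : ℂ) • h) ≤ max α β * KConst f h := by
  obtain ⟨hf₁, hf₂, hc, hp, hn⟩ := le_KConst f h
  have hK := KConst_nonneg f h
  have hnorm (u : OneParticle D m) (hu : ‖u‖ ≤ KConst f h) :
      ‖(α : ℂ) • u‖ ≤ max α β * KConst f h := by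
    rw [norm_smul, Complex.norm_of_nonneg hα]
    gcongr
    exact le_max_left _ _
  have hmul {x : ℝ} (hx : x ≤ KConst f h) : β * x ≤ max α β * KConst f h :=
    (mul_le_mul_of_nonneg_left hx hβ).trans (mul_le_mul_of_nonneg_right (le_max_right _ _) hK)
  refine max_le (max_le (hnorm f.1 hf₁) (hnorm f.2 hf₂))
    (max_le ((cConst_smul_le hm h hβ).trans (hmul hc)) (max_le ?_ ?_))
  · exact (pairNorm_smul m h hβ 1).trans_le (hmul hp)
  · exact (pairNorm_smul m h hβ (-1)).trans_le (hmul hn)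

theorem stepBound_field_add_wickSquare (hD : 1 ≤ D) (hm : 0 < m) (f : Smearing D m)
    (h : SchwartzMap (Spacetime D) ℂ) :
    StepBound (field f + wickSquare m h) (10 * KConst f h) := by
  refine ((stepBound_field f).add (stepBound_wickSquare hD hm h)).mono ?_
  obtain ⟨hf₁, hf₂, hc, hp, hn⟩ := le_KConst f h
  linarith [KConst_nonneg f h]

theorem norm_list_prod_field_add_wickSquare_le (hD : 1 ≤ D) (hm : 0 < m) {k n : ℕ}
    (f : Fin k → Smearing D m) (h : Fin k → SchwartzMap (Spacetime D) ℂ) {ψ : FiniteParticle D m}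
    (hψ : AtMost n (ψ : Fock D m)) :
    ‖(List.ofFn fun j : Fin k => field (f j) + wickSquare m (h j)).prod ψ‖ ≤
      20 ^ k * Real.Gamma (k + ((n : ℝ) + 1) / 2) / Real.Gamma (((n : ℝ) + 1) / 2) *
        (∏ j, KConst (f j) (h j)) * ‖ψ‖ := by
  refine (StepBound.norm_list_prod_le (K := fun j => 10 * KConst (f j) (h j))
    (fun j => mul_nonneg (by norm_num) (KConst_nonneg (f j) (h j)))
    (fun j => stepBound_field_add_wickSquare hD hm (f j) (h j)) hψ).trans_eq ?_
  rw [Finset.prod_mul_distrib, Finset.prod_const, Finset.card_univ, Fintype.card_fin,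
    show (20 : ℝ) = 2 * 10 by norm_num, mul_pow]
  ring

theorem isEssentiallySelfAdjoint_field_add_wickSquare (hD : 1 ≤ D) (hm : 0 < m) {f : Smearing D m}
    {h : SchwartzMap (Spacetime D) ℂ} (hf : f.IsReal) (hh : ∀ x, (h x).im = 0) :
    IsEssentiallySelfAdjoint (toPMap (field f + wickSquare m h)) :=
  StepBound.isEssentiallySelfAdjoint (lt_max_of_lt_right zero_lt_one)
    ((stepBound_field_add_wickSquare hD hm f h).mono (le_max_left _ 1))
    ((isSymmetric_field hf).add (isSymmetric_wickSquare hD hm hh))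

end Constants

end FreeField

end

open FreeField in
theorem mainTheorem3 (D : ℕ) (hD : 1 ≤ D) (m : ℝ) (hm : 0 < m) :
    -- the field and the Wick square are well defined on the finite-particle subspace
    (∀ f : Smearing D m, IsField f (field f)) ∧
    (∀ h : SchwartzMap (Spacetime D) ℂ, IsWickSquare h (wickSquare m h)) ∧
    -- the bound
    (∀ (k n : ℕ) (f : Fin k → Smearing D m) (h : Fin k → SchwartzMap (Spacetime D) ℂ)
      (ψ : FiniteParticle D m), AtMost n (ψ : Fock D m) →
      ‖(List.ofFn fun j : Fin k => field (f j) + wickSquare m (h j)).prod ψ‖ ≤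
        20 ^ k * Real.Gamma (k + ((n : ℝ) + 1) / 2) / Real.Gamma (((n : ℝ) + 1) / 2) *
          (∏ j, KConst (f j) (h j)) * ‖ψ‖) ∧
    -- the scaling of the constant
    (∀ (f : Smearing D m) (h : SchwartzMap (Spacetime D) ℂ) (α β : ℝ), 0 ≤ α → 0 ≤ β →
      KConst ((α : ℂ) • f) ((β : ℂ) • h) ≤ max α β * KConst f h) ∧
    -- essential self-adjointness
    (∀ (f : Smearing D m) (h : SchwartzMap (Spacetime D) ℂ) (α β : ℂ),
      (α • f).IsReal → (∀ x, ((β • h) x).im = 0) →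
      IsEssentiallySelfAdjoint (toPMap (α • field f + β • wickSquare m h))) := by
  refine ⟨isField_field, isWickSquare_wickSquare hD hm,
    fun k n f h ψ hψ => norm_list_prod_field_add_wickSquare_le hD hm f h hψ,
    fun f h α β hα hβ => KConst_smul_le hm f h hα hβ, fun f h α β hf hh => ?_⟩
  rw [← field_smul, ← wickSquare_smul hD hm]
  exact isEssentiallySelfAdjoint_field_add_wickSquare hD hm hf hh
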